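/- For a finite nonempty set $P\subseteq\mathbb R^n$ let $f_{\min}(P)\in\mathbb R^n$ be the point whose $i$-th coordinate is the minimum of the $i$-th coordinates of the points of $P$ ($1\le i\le n$), and for $Z\subseteq\mathbb R^n$ let $F_{\min}(Z)=\{f_{\min}(P) : P \text{ a nonempty finite subset of } Z\}$. Let $\mathrm{conv}$ denote the convex hull. Theorem. There is an algorithm (a single program, uniform in $n$ and $m$, for a real random access machine, in which an arithmetic operation on reals, an exact comparison of reals, an addition or subtraction of integer addresses and a memory access each cost one step) and a constant $C$ such that, for all $n\ge 1$ and $m\ge 1$ and every set $S\subseteq\mathbb R^n$ with $|S|=m$, given as a list of its points, the algorithm halts after at most $m^{C\cdot n\cdot 2^n}\cdot 2^{C\cdot n^3}$ steps, i.e. in time $m^{O(n\cdot 2^n)}\cdot 2^{O(n^3)}$, and outputs (as a list of points) a finite set $S'\subseteq\mathbb R^n$ with $$|S'|\le m^{2^n}\cdot 2^{n^2+n},\qquad S\subseteq S'\subseteq \mathrm{conv}(S),\qquad F_{\min}(\mathrm{conv}(S))=\mathrm{conv}(F_{\min}(S')).$$ -/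

import Mathlib

/-- `fmin P`, the pointwise minimum of a nonempty finite set `P` of points of `ℝⁿ`: its `i`-th
coordinate is the minimum of the `i`-th coordinates of the points of `P`. -/
noncomputable def fmin {n : ℕ} (P : Finset (Fin n → ℝ)) (hP : P.Nonempty) : Fin n → ℝ :=
  fun i => P.inf' hP (fun p => p i)

/-- `Fmin S`, the set of all points `fmin P` for `P` a (nonempty) finite subset of `S`. -/
def Fmin {n : ℕ} (S : Set (Fin n → ℝ)) : Set (Fin n → ℝ) :=
  {x | ∃ (P : Finset (Fin n → ℝ)) (hP : P.Nonempty), (P : Set (Fin n → ℝ)) ⊆ S ∧ x = fmin P hP}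

/-! ### The real random access machine

The usual uniform machine model for algorithms on real vectors. The memory consists of an array of
natural numbers (counters and addresses) and an array of real numbers. Real arithmetic with
rational constants, exact comparison of reals, addition and truncated subtraction of naturals,
and a memory access through a computed address cost one step each. Programs are finite
while-programs. There is no rounding operation, and no way to turn a real into a natural number
other than by branching on comparisons. -/

namespace RealRAM

/-- A memory content: the array of naturals and the array of reals. -/
structure State where
  nat : ℕ → ℕ
  real : ℕ → ℝ

/-- Expressions with a natural value; `mem a` reads the cell whose address is the value of `a`. -/
inductive NatExpr : Type
  | const (c : ℕ)
  | mem (a : NatExpr)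
  | add (a b : NatExpr)
  | sub (a b : NatExpr)

namespace NatExpr

def eval (σ : State) : NatExpr → ℕ
  | const c => c
  | mem a => σ.nat (a.eval σ)
  | add a b => a.eval σ + b.eval σ
  | sub a b => a.eval σ - b.eval σ

/-- The number of elementary operations needed to evaluate the expression. -/
def cost : NatExpr → ℕ
  | const _ => 1
  | mem a => a.cost + 1
  | add a b => a.cost + b.cost + 1
  | sub a b => a.cost + b.cost + 1

end NatExpr

/-- Expressions with a real value. Only rational constants are allowed in a program. Division by
zero returns zero. -/
inductive RealExpr : Type
  | const (q : ℚ)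
  | mem (a : NatExpr)
  | add (a b : RealExpr)
  | sub (a b : RealExpr)
  | mul (a b : RealExpr)
  | div (a b : RealExpr)

namespace RealExpr

noncomputable def eval (σ : State) : RealExpr → ℝ
  | const q => (q : ℝ)
  | mem a => σ.real (a.eval σ)
  | add a b => a.eval σ + b.eval σ
  | sub a b => a.eval σ - b.eval σ
  | mul a b => a.eval σ * b.eval σ
  | div a b => a.eval σ / b.eval σ

/-- The number of elementary operations needed to evaluate the expression. -/
def cost : RealExpr → ℕ
  | const _ => 1
  | mem a => a.cost + 1
  | add a b => a.cost + b.cost + 1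
  | sub a b => a.cost + b.cost + 1
  | mul a b => a.cost + b.cost + 1
  | div a b => a.cost + b.cost + 1

end RealExpr

/-- Tests: comparisons of naturals, comparisons of reals, and their Boolean combinations. -/
inductive Test : Type
  | natLt (a b : NatExpr)
  | natEq (a b : NatExpr)
  | realLt (a b : RealExpr)
  | realEq (a b : RealExpr)
  | not (b : Test)
  | and (b c : Test)

namespace Test

/-- The test `b` succeeds in the state `σ`. -/
def Holds (σ : State) : Test → Prop
  | natLt a b => a.eval σ < b.eval σ
  | natEq a b => a.eval σ = b.eval σ
  | realLt a b => a.eval σ < b.eval σ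
  | realEq a b => a.eval σ = b.eval σ
  | not b => ¬ b.Holds σ
  | and b c => b.Holds σ ∧ c.Holds σ

/-- The number of elementary operations needed to evaluate the test. -/
def cost : Test → ℕ
  | natLt a b => a.cost + b.cost + 1
  | natEq a b => a.cost + b.cost + 1
  | realLt a b => a.cost + b.cost + 1
  | realEq a b => a.cost + b.cost + 1
  | not b => b.cost + 1
  | and b c => b.cost + c.cost + 1

end Test

/-- Programs. `setNat a e` and `setReal a e` write the value of `e` to the cell, of the array of
naturals respectively reals, whose address is the value of `a`. -/
inductive Program : Type
  | skip
  | setNat (a e : NatExpr)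
  | setReal (a : NatExpr) (e : RealExpr)
  | seq (p q : Program)
  | ite (b : Test) (p q : Program)
  | loop (b : Test) (p : Program)

/-- `Exec p σ t τ`: the program `p`, started in the state `σ`, halts after exactly `t` steps in the
state `τ`. The program `loop b p` is "while `b` do `p`". -/
inductive Exec : Program → State → ℕ → State → Prop
  | skip (σ : State) : Exec Program.skip σ 1 σ
  | setNat (a e : NatExpr) (σ : State) :
      Exec (Program.setNat a e) σ (a.cost + e.cost + 1)
        { σ with nat := Function.update σ.nat (a.eval σ) (e.eval σ) }
  | setReal (a : NatExpr) (e : RealExpr) (σ : State) :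
      Exec (Program.setReal a e) σ (a.cost + e.cost + 1)
        { σ with real := Function.update σ.real (a.eval σ) (e.eval σ) }
  | seq {p q : Program} {σ τ υ : State} {t u : ℕ} :
      Exec p σ t τ → Exec q τ u υ → Exec (Program.seq p q) σ (t + u) υ
  | iteTrue {b : Test} {p : Program} (q : Program) {σ τ : State} {t : ℕ} :
      b.Holds σ → Exec p σ t τ → Exec (Program.ite b p q) σ (b.cost + t + 1) τ
  | iteFalse {b : Test} (p : Program) {q : Program} {σ τ : State} {t : ℕ} :
      ¬ b.Holds σ → Exec q σ t τ → Exec (Program.ite b p q) σ (b.cost + t + 1) τ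
  | loopTrue {b : Test} {p : Program} {σ τ υ : State} {t u : ℕ} :
      b.Holds σ → Exec p σ t τ → Exec (Program.loop b p) τ u υ →
        Exec (Program.loop b p) σ (b.cost + t + u + 1) υ
  | loopFalse {b : Test} (p : Program) {σ : State} :
      ¬ b.Holds σ → Exec (Program.loop b p) σ (b.cost + 1) σ

/-- The initial memory for a list `s` of `m` points of `ℝⁿ`: the first two natural cells hold `n`
and `m`, coordinate `j` of the point `s i` is in the real cell `i * n + j`, and all other cells
hold zero. -/
noncomputable def input {n m : ℕ} (s : Fin m → Fin n → ℝ) : State where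
  nat := fun a => if a = 0 then n else if a = 1 then m else 0
  real := fun a =>
    if h : a < m * n then
      s (finProdFinEquiv.symm ⟨a, h⟩).1 (finProdFinEquiv.symm ⟨a, h⟩).2
    else 0

/-- The finite set of points of `ℝⁿ` that a final memory represents: natural cell `0` holds the
length `k` of a list of points, and coordinate `j` of the `i`-th point, `i < k`, is in the real
cell `i * n + j`. -/
def output (n : ℕ) (τ : State) : Set (Fin n → ℝ) :=
  {p | ∃ i < τ.nat 0, p = fun j : Fin n => τ.real (i * n + (j : ℕ))}

end RealRAM

/-! A point x of Fmin(conv S) needs only n witnesses: points p_1, …, p_n of conv S such that p_i has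
the i-th coordinate of x and no p_b is smaller there (`mem_Fmin_iff`). Let l_i be a vector of convex
weights for p_i. The tuples l form the compact convex set `weightPolytope s`, cut out of a product
of simplices by n² linear inequalities, and x is a linear function of l (`diagonalPoint`). By
Krein–Milman it is enough to treat the extreme points l. Conversely Fmin of a convex set is convex,
so S' ⊆ conv S gives the other inclusion (`Fmin_convexHull_eq`).

Let A be the support of an extreme point l and T its set of tight inequalities. A perturbation
argument shows that A and T determine l: the homogeneous system "zero outside A, all blocks have the
same sum t, equality on T" has only the multiples of (l, 1) as solutions
(`eq_zero_of_mem_extremePoints`). If all inequalities are tight, the p_i coincide and x lies in conv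
S, so S itself suffices. Otherwise a dimension count gives |A| ≤ n + (n² - n - 1) = n² - 1
(`card_weightSupport_le`).

The algorithm therefore runs through all pairs (A, T) with |A| ≤ n² - 1, coded by the numerals with
2n² - 1 digits in base nm. To solve a system without distinguishing ranks, it projects the last unit
vector (the direction of t) orthogonally to the solution space: this vector is put below the rows of
the system, and Gram–Schmidt turns it into the projection (`isSysProj_of_orthogonalized`). At an
extreme point the projection is a positive multiple of (l, 1), and division by t recovers l. For an
arbitrary system, every block with t > 0 and nonnegative weights yields a point of conv S, so
nothing false is ever written.

For the size of S', at most m^(n²-1)·e^n supports, 2^(n²-n) sets of off-diagonal constraints and n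
blocks have to be counted, besides S (`card_foundPoints_le`). For the time, one number Z bounds the
rounds of every loop, and the running time of the fixed program is polynomial in Z. -/

namespace RealRAM

/-! ### Running time of programs with bounded loops -/

/-- A bound for the running time of a program each of whose loops makes at most `Z` rounds. -/
def Program.timeBound (Z : ℕ) : Program → ℕ
  | .skip => 1
  | .setNat a e => a.cost + e.cost + 1
  | .setReal a e => a.cost + e.cost + 1
  | .seq p q => p.timeBound Z + q.timeBound Z
  | .ite b p q => b.cost + p.timeBound Z + q.timeBound Z + 1
  | .loop b p => Z * (b.cost + p.timeBound Z + 1) + (b.cost + 1)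

/-- The program is fixed, so nesting of loops contributes only a fixed power of `Z`. Adding the
exponents of the parts instead of taking their maximum is crude but sufficient. -/
theorem Program.exists_timeBound_le (p : Program) :
    ∃ c d : ℕ, ∀ Z, 1 ≤ Z → p.timeBound Z ≤ c * Z ^ d := by
  have key : ∀ {c d d' Z : ℕ}, 1 ≤ Z → d ≤ d' → c * Z ^ d ≤ c * Z ^ d' := fun hZ h =>
    Nat.mul_le_mul_left _ (Nat.pow_le_pow_right hZ h)
  induction p with
  | skip => exact ⟨1, 0, fun Z _ => by simp [timeBound]⟩
  | setNat a e => exact ⟨a.cost + e.cost + 1, 0, fun Z _ => by simp [timeBound]⟩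
  | setReal a e => exact ⟨a.cost + e.cost + 1, 0, fun Z _ => by simp [timeBound]⟩
  | seq p q hp hq =>
    obtain ⟨c, d, h⟩ := hp
    obtain ⟨c', d', h'⟩ := hq
    refine ⟨c + c', d + d', fun Z hZ => ?_⟩
    have h1 := (h Z hZ).trans (key hZ (Nat.le_add_right d d'))
    have h2 := (h' Z hZ).trans (key hZ (Nat.le_add_left d' d))
    simp only [timeBound, add_mul]
    omega
  | ite b p q hp hq =>
    obtain ⟨c, d, h⟩ := hp
    obtain ⟨c', d', h'⟩ := hq
    refine ⟨b.cost + 1 + c + c', d + d', fun Z hZ => ?_⟩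
    have h1 := (h Z hZ).trans (key hZ (Nat.le_add_right d d'))
    have h2 := (h' Z hZ).trans (key hZ (Nat.le_add_left d' d))
    have h3 := key (c := b.cost + 1) hZ (Nat.zero_le (d + d'))
    rw [pow_zero, mul_one] at h3
    simp only [timeBound, add_mul] at *
    omega
  | loop b p hp =>
    obtain ⟨c, d, h⟩ := hp
    refine ⟨2 * b.cost + c + 2, d + 1, fun Z hZ => ?_⟩
    have h1 := Nat.mul_le_mul_left Z (h Z hZ)
    have h3 := key (c := b.cost + 1) hZ (Nat.zero_le (d + 1))
    have h4 := key (c := b.cost + 1) hZ (Nat.le_add_left 1 d)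
    simp only [timeBound]
    simp only [pow_zero, pow_one] at h3 h4
    have h5 : Z * (c * Z ^ d) = c * Z ^ (d + 1) := by ring
    nlinarith

/-- Induction on the number of rounds left. The invariant is indexed by the rounds already made, and
the exact number `K` of rounds is known beforehand, so no other termination measure is needed. -/
theorem exec_loop {Z : ℕ} {b : Test} {p : Program} {σ : State} (I : ℕ → State → Prop) (K : ℕ)
    (hK : K ≤ Z) (h0 : I 0 σ)
    (step : ∀ k < K, ∀ σ, I k σ → b.Holds σ ∧
      ∃ t ≤ p.timeBound Z, ∃ τ, Exec p σ t τ ∧ I (k + 1) τ)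
    (last : ∀ σ, I K σ → ¬ b.Holds σ) :
    ∃ t ≤ (Program.loop b p).timeBound Z, ∃ τ, Exec (.loop b p) σ t τ ∧ I K τ := by
  have key : ∀ j k σ, j + k = K → I k σ →
      ∃ t ≤ j * (b.cost + p.timeBound Z + 1) + (b.cost + 1), ∃ τ,
        Exec (.loop b p) σ t τ ∧ I K τ := by
    intro j
    induction j with
    | zero =>
      intro k σ hk hI
      obtain rfl : k = K := by omega
      exact ⟨b.cost + 1, by omega, σ, .loopFalse _ (last σ hI), hI⟩
    | succ j ih =>
      intro k σ hk hI
      obtain ⟨hb, t, ht, σ1, h1, hI1⟩ := step k (by omega) σ hI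
      obtain ⟨t', ht', τ, h2, hQ⟩ := ih (k + 1) σ1 (by omega) hI1
      refine ⟨_, ?_, τ, .loopTrue hb h1 h2, hQ⟩
      have : (j + 1) * (b.cost + p.timeBound Z + 1) =
        j * (b.cost + p.timeBound Z + 1) + (b.cost + p.timeBound Z + 1) := by ring
      omega
  obtain ⟨t, ht, τ, h, hQ⟩ := key K 0 σ rfl h0
  refine ⟨t, ht.trans ?_, τ, h, hQ⟩
  simp only [Program.timeBound]
  have := Nat.mul_le_mul_right (b.cost + p.timeBound Z + 1) hK
  omega

/-! ### Structured memory -/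

/-- A structured memory: natural variables, an array of naturals, the input array, two further
arrays of reals, and real variables. -/
structure Mem where
  v : ℕ → ℕ
  g : ℕ → ℕ
  s : ℕ → ℝ
  u : ℕ → ℝ
  o : ℕ → ℝ
  r : ℕ → ℝ

/-- The memory layout: the input occupies the first `N` real cells, the other real arrays are
interleaved behind it. -/
noncomputable def enc (N : ℕ) (M : Mem) : State where
  nat a := if a < 64 then M.v a else M.g (a - 64)
  real a := if a < N then M.s a else
    if (a - N) % 3 = 0 then M.o ((a - N) / 3)
    else if (a - N) % 3 = 1 then M.u ((a - N) / 3) else M.r ((a - N) / 3)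

/-- The natural variable `x`. -/
abbrev V (x : ℕ) : NatExpr := .mem (.const x)

/-- The entry of the array of naturals with index `e`. -/
abbrev G (e : NatExpr) : NatExpr := .mem (.add (.const 64) e)

/-- The address of the entry with index `e` of the interleaved array number `k`. -/
def arr (k : ℕ) (e : NatExpr) : NatExpr := .add (V 2) (.add (.add e (.add e e)) (.const k))

/-- Sequential composition. -/
infixr:60 " ;; " => Program.seq

/-- `for x < e do p`. -/
def forLoop (x : ℕ) (e : NatExpr) (p : Program) : Program :=
  .setNat (.const x) (.const 0) ;;
    .loop (.natLt (V x) e) (p ;; .setNat (.const x) (.add (V x) (.const 1)))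

section eval
variable {N : ℕ} {M : Mem}

theorem eval_V {x : ℕ} (hx : x < 64) : (V x).eval (enc N M) = M.v x := by
  simp [NatExpr.eval, enc, hx]

theorem eval_G (e : NatExpr) : (G e).eval (enc N M) = M.g (e.eval (enc N M)) := by
  simp [NatExpr.eval, enc]

theorem eval_arr (k : ℕ) (e : NatExpr) :
    (arr k e).eval (enc N M) = M.v 2 + (3 * e.eval (enc N M) + k) := by
  simp only [arr, NatExpr.eval]
  simp only [enc]
  simp
  ring

/-- The layout is fixed by `N`, whereas the program computes addresses from its variable 2; `h` says
that they agree. Before the sizes are computed, no array behind the input may be used. -/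
theorem enc_real_u (h : M.v 2 = N) (i : ℕ) : (enc N M).real (M.v 2 + (3 * i + 1)) = M.u i := by
  have h1 : (3 * i + 1) % 3 = 1 := by omega
  have h2 : (3 * i + 1) / 3 = i := by omega
  simp [enc, h, h1, h2]

theorem enc_real_r (h : M.v 2 = N) (i : ℕ) : (enc N M).real (M.v 2 + (3 * i + 2)) = M.r i := by
  have h1 : (3 * i + 2) % 3 = 2 := by omega
  have h2 : (3 * i + 2) / 3 = i := by omega
  simp [enc, h, h1, h2]

theorem eval_u (h : M.v 2 = N) (e : NatExpr) :
    (RealExpr.mem (arr 1 e)).eval (enc N M) = M.u (e.eval (enc N M)) := by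
  rw [RealExpr.eval, eval_arr, enc_real_u h]

theorem eval_r (h : M.v 2 = N) (e : NatExpr) :
    (RealExpr.mem (arr 2 e)).eval (enc N M) = M.r (e.eval (enc N M)) := by
  rw [RealExpr.eval, eval_arr, enc_real_r h]

theorem eval_s (e : NatExpr) (h : e.eval (enc N M) < N) :
    (RealExpr.mem e).eval (enc N M) = M.s (e.eval (enc N M)) := by
  rw [RealExpr.eval]
  show ite _ _ _ = _
  rw [if_pos h]

theorem enc_setV {x : ℕ} (hx : x < 64) (k : ℕ) :
    { enc N M with nat := Function.update (enc N M).nat x k } =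
      enc N { M with v := Function.update M.v x k } := by
  simp only [enc, State.mk.injEq, and_true]
  funext a
  by_cases h : a = x
  · subst h; simp [hx]
  · simp [h]

theorem enc_setG (i k : ℕ) :
    { enc N M with nat := Function.update (enc N M).nat (64 + i) k } =
      enc N { M with g := Function.update M.g i k } := by
  simp only [enc, State.mk.injEq, and_true]
  funext a
  by_cases h : a = 64 + i
  · subst h; simp
  · by_cases ha : a < 64
    · simp [h, ha]
    · have : a - 64 ≠ i := by omega
      simp [h, ha, this]

theorem enc_setO (h : M.v 2 = N) (i : ℕ) (q : ℝ) :
    { enc N M with real := Function.update (enc N M).real (M.v 2 + (3 * i + 0)) q } =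
      enc N { M with o := Function.update M.o i q } := by
  simp only [enc, State.mk.injEq, true_and, h]
  funext a
  by_cases ha : a = N + (3 * i + 0)
  · subst ha; simp
  · by_cases h1 : a < N
    · simp only [Function.update_apply, ha, h1, if_true, if_false]
    · by_cases h2 : (a - N) % 3 = 0
      · have : (a - N) / 3 ≠ i := by omega
        simp only [Function.update_apply, ha, h1, h2, this, if_true, if_false]
      · simp only [Function.update_apply, ha, h1, h2, if_false]

theorem enc_setU (h : M.v 2 = N) (i : ℕ) (q : ℝ) :
    { enc N M with real := Function.update (enc N M).real (M.v 2 + (3 * i + 1)) q } =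
      enc N { M with u := Function.update M.u i q } := by
  simp only [enc, State.mk.injEq, true_and, h]
  funext a
  by_cases ha : a = N + (3 * i + 1)
  · have h0 : ¬ a < N := by omega
    have h1 : (a - N) % 3 = 1 := by omega
    have h2 : (a - N) / 3 = i := by omega
    simp [← ha, h0, h1, h2]
  · by_cases h1 : a < N
    · simp [ha, h1]
    · by_cases h2 : (a - N) % 3 = 1
      · have : (a - N) / 3 ≠ i := by omega
        simp only [Function.update_apply, ha, h1, h2, this, if_false]
      · simp only [Function.update_apply, ha, h1, h2, if_false]

theorem enc_setR (h : M.v 2 = N) (i : ℕ) (q : ℝ) :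
    { enc N M with real := Function.update (enc N M).real (M.v 2 + (3 * i + 2)) q } =
      enc N { M with r := Function.update M.r i q } := by
  simp only [enc, State.mk.injEq, true_and, h]
  funext a
  by_cases ha : a = N + (3 * i + 2)
  · have h0 : ¬ a < N := by omega
    have h1 : (a - N) % 3 = 2 := by omega
    have h2 : (a - N) / 3 = i := by omega
    simp [← ha, h0, h1, h2]
  · by_cases h1 : a < N
    · simp [ha, h1]
    · by_cases h2 : (a - N) % 3 = 2
      · have : (a - N) / 3 ≠ i := by omega
        simp only [Function.update_apply, ha, h1, h2, this, if_false]
      · by_cases h3 : (a - N) % 3 = 0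
        · simp only [Function.update_apply, ha, h1, h3, if_false, if_true]
        · have h4 : (a - N) % 3 = 1 := by omega
          simp only [Function.update_apply, ha, h1, h4, if_false, if_true]

end eval

/-! ### Total correctness -/

/-- The program `p`, started in the memory `M`, halts within the time `p.timeBound Z` in a memory
that satisfies `Q`. -/
def Runs (Z N : ℕ) (p : Program) (M : Mem) (Q : Mem → Prop) : Prop :=
  ∃ t ≤ p.timeBound Z, ∃ M', Exec p (enc N M) t (enc N M') ∧ Q M'

namespace Runs
variable {Z N : ℕ} {M : Mem} {Q : Mem → Prop}

theorem mono {p : Program} {Q' : Mem → Prop} (h : Runs Z N p M Q') (hQ : ∀ M', Q' M' → Q M') :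
    Runs Z N p M Q := by
  obtain ⟨t, ht, M', hM', hQ'⟩ := h
  exact ⟨t, ht, M', hM', hQ _ hQ'⟩

theorem skip (h : Q M) : Runs Z N .skip M Q := ⟨1, le_rfl, M, .skip _, h⟩

/-- The postcondition of the first part is again a `Runs` statement, as in a weakest precondition
calculus, so correctness proofs can follow the text of the program. -/
theorem seq {p q : Program} (h : Runs Z N p M fun M' => Runs Z N q M' Q) :
    Runs Z N (p ;; q) M Q := by
  obtain ⟨t, ht, M', hM', t', ht', M'', hM'', hQ⟩ := h
  exact ⟨t + t', Nat.add_le_add ht ht', M'', .seq hM' hM'', hQ⟩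

theorem ite {b : Test} {p q : Program} (hp : b.Holds (enc N M) → Runs Z N p M Q)
    (hq : ¬ b.Holds (enc N M) → Runs Z N q M Q) : Runs Z N (.ite b p q) M Q := by
  by_cases hb : b.Holds (enc N M)
  · obtain ⟨t, ht, M', hM', hQ⟩ := hp hb
    refine ⟨_, ?_, M', .iteTrue q hb hM', hQ⟩
    simp only [Program.timeBound]; omega
  · obtain ⟨t, ht, M', hM', hQ⟩ := hq hb
    refine ⟨_, ?_, M', .iteFalse p hb hM', hQ⟩
    simp only [Program.timeBound]; omega

theorem setV {x : ℕ} {e : NatExpr} (hx : x < 64)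
    (h : Q { M with v := Function.update M.v x (e.eval (enc N M)) }) :
    Runs Z N (.setNat (.const x) e) M Q := by
  refine ⟨_, le_rfl, _, ?_, h⟩
  rw [← enc_setV hx]
  exact .setNat _ _ _

theorem setG {i e : NatExpr}
    (h : Q { M with g := Function.update M.g (i.eval (enc N M)) (e.eval (enc N M)) }) :
    Runs Z N (.setNat (.add (.const 64) i) e) M Q := by
  refine ⟨_, le_rfl, _, ?_, h⟩
  rw [← enc_setG]
  exact .setNat _ _ _

theorem setO {i : NatExpr} {e : RealExpr} (hN : M.v 2 = N)
    (h : Q { M with o := Function.update M.o (i.eval (enc N M)) (e.eval (enc N M)) }) :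
    Runs Z N (.setReal (arr 0 i) e) M Q := by
  refine ⟨_, le_rfl, _, ?_, h⟩
  rw [← enc_setO hN, ← eval_arr]
  exact .setReal _ _ _

theorem setU {i : NatExpr} {e : RealExpr} (hN : M.v 2 = N)
    (h : Q { M with u := Function.update M.u (i.eval (enc N M)) (e.eval (enc N M)) }) :
    Runs Z N (.setReal (arr 1 i) e) M Q := by
  refine ⟨_, le_rfl, _, ?_, h⟩
  rw [← enc_setU hN, ← eval_arr]
  exact .setReal _ _ _

theorem setR {i : NatExpr} {e : RealExpr} (hN : M.v 2 = N)
    (h : Q { M with r := Function.update M.r (i.eval (enc N M)) (e.eval (enc N M)) }) :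
    Runs Z N (.setReal (arr 2 i) e) M Q := by
  refine ⟨_, le_rfl, _, ?_, h⟩
  rw [← enc_setR hN, ← eval_arr]
  exact .setReal _ _ _

theorem loop {b : Test} {p : Program} (I : ℕ → Mem → Prop) (K : ℕ) (hK : K ≤ Z) (h0 : I 0 M)
    (step : ∀ k < K, ∀ M', I k M' → b.Holds (enc N M') ∧ Runs Z N p M' (I (k + 1)))
    (last : ∀ M', I K M' → ¬ b.Holds (enc N M') ∧ Q M') : Runs Z N (.loop b p) M Q := by
  obtain ⟨t, ht, _, h, M', rfl, hI⟩ := exec_loop (b := b) (p := p) (σ := enc N M)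
    (fun k σ => ∃ M', σ = enc N M' ∧ I k M') K hK ⟨M, rfl, h0⟩ (by
      rintro k hk _ ⟨M', rfl, hI⟩
      obtain ⟨hb, t, ht, M'', h, hI'⟩ := step k hk M' hI
      exact ⟨hb, t, ht, _, h, M'', rfl, hI'⟩)
    (by
      rintro _ ⟨M', rfl, hI⟩
      exact (last M' hI).1)
  exact ⟨t, ht, M', h, (last M' hI).2⟩

/-- The bound `e` is evaluated again in each round, whence `he`; the body has to leave the counter
`x` unchanged, and the invariant is required after the increment. -/
theorem forLoop {x : ℕ} {e : NatExpr} {p : Program} (I : ℕ → Mem → Prop) (K : ℕ) (hx : x < 64)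
    (hK : K ≤ Z) (h0 : I 0 { M with v := Function.update M.v x 0 })
    (he : ∀ k ≤ K, ∀ M', M'.v x = k → I k M' → e.eval (enc N M') = K)
    (step : ∀ k < K, ∀ M', M'.v x = k → I k M' → Runs Z N p M' fun M'' =>
      M''.v x = k ∧ I (k + 1) { M'' with v := Function.update M''.v x (k + 1) })
    (last : ∀ M', M'.v x = K → I K M' → Q M') : Runs Z N (RealRAM.forLoop x e p) M Q := by
  refine Runs.seq (Runs.setV hx ?_)
  refine Runs.loop (fun k M' => M'.v x = k ∧ I k M') K hK ⟨?_, h0⟩ ?_ ?_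
  · simp [NatExpr.eval]
  · rintro k hk M' ⟨hxk, hI⟩
    refine ⟨?_, Runs.seq ((step k hk M' hxk hI).mono ?_)⟩
    · simp only [Test.Holds]
      rw [eval_V hx, hxk, he k hk.le M' hxk hI]
      exact hk
    · rintro M'' ⟨hxk', hI'⟩
      refine Runs.setV hx ?_
      have h2 : (NatExpr.add (V x) (.const 1)).eval (enc N M'') = k + 1 := by
        rw [NatExpr.eval, eval_V hx, hxk']; rfl
      rw [h2]
      exact ⟨by simp, hI'⟩
  · rintro M' ⟨hxk, hI⟩
    refine ⟨?_, last M' hxk hI⟩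
    simp only [Test.Holds]
    rw [eval_V hx, hxk, he K le_rfl M' hxk hI]
    exact lt_irrefl _

end Runs

end RealRAM

namespace RealRAM

/-! ### The program -/

/-- `x := x + e` -/
def incr (x : ℕ) (e : NatExpr) : Program := .setNat (.const x) (.add (V x) e)

/-- The real variable `k`. -/
abbrev R (k : ℕ) : RealExpr := .mem (arr 2 (.const k))

/-- The entry with index `e` of the matrix. -/
abbrev U (e : NatExpr) : RealExpr := .mem (arr 1 e)

/-- Write the value of `e` behind the part of the matrix that has been written already. -/
def emit (e : RealExpr) : Program := .setReal (arr 1 (V 20)) e ;; incr 20 (.const 1)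

/-- Write the rows `e_c` for `c` outside the chosen support, and zero rows for the other `c`. -/
def emitSupport : Program :=
  forLoop 10 (V 2) (
    .setNat (.const 12) (.const 1) ;;
    forLoop 11 (V 4) (.ite (.natEq (G (V 11)) (V 10)) (.setNat (.const 12) (.const 0)) .skip) ;;
    forLoop 11 (V 2) (.ite (.and (.natEq (V 11) (V 10)) (.natEq (V 12) (.const 1)))
      (emit (.const 1)) (emit (.const 0))) ;;
    emit (.const 0))

/-- Write the rows saying that all blocks have the same sum. -/
def emitSums : Program :=
  forLoop 10 (V 0) (
    forLoop 11 (V 0) (forLoop 12 (V 1) (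
      .ite (.natEq (V 11) (V 10)) (emit (.const 1)) (emit (.const 0)))) ;;
    emit (.const (-1)))

/-- Write the rows for the chosen tight constraints. -/
def emitTight : Program :=
  .setNat (.const 21) (V 4) ;;
  forLoop 10 (V 0) (forLoop 11 (V 0) (
    forLoop 12 (V 0) (
      .setNat (.const 13) (V 10) ;;
      forLoop 14 (V 1) (
        .setReal (arr 2 (.const 0)) (.const 0) ;;
        .ite (.natEq (G (V 21)) (.const 0))
          (.ite (.natEq (V 12) (V 11))
            (.setReal (arr 2 (.const 0)) (.add (R 0) (.mem (V 13)))) .skip ;;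
          .ite (.natEq (V 12) (V 10))
            (.setReal (arr 2 (.const 0)) (.sub (R 0) (.mem (V 13)))) .skip) .skip ;;
        emit (R 0) ;;
        incr 13 (V 0))) ;;
    emit (.const 0) ;;
    incr 21 (.const 1)))

/-- Write the last unit vector. -/
def emitLast : Program := forLoop 10 (V 2) (emit (.const 0)) ;; emit (.const 1)

/-- Write the matrix belonging to the current digits. -/
def emitMatrix : Program :=
  .setNat (.const 20) (.const 0) ;; emitSupport ;; emitSums ;; emitTight ;; emitLast

/-- Make the row at `15` orthogonal to the row at `16`. -/
def reduceRow : Program :=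
  .setReal (arr 2 (.const 0)) (.const 0) ;;
  .setReal (arr 2 (.const 1)) (.const 0) ;;
  forLoop 12 (V 3) (
    .setReal (arr 2 (.const 0))
      (.add (R 0) (.mul (U (.add (V 15) (V 12))) (U (.add (V 16) (V 12))))) ;;
    .setReal (arr 2 (.const 1))
      (.add (R 1) (.mul (U (.add (V 16) (V 12))) (U (.add (V 16) (V 12)))))) ;;
  .setReal (arr 2 (.const 0)) (.div (R 0) (R 1)) ;;
  forLoop 12 (V 3) (
    .setReal (arr 1 (.add (V 15) (V 12)))
      (.sub (U (.add (V 15) (V 12))) (.mul (R 0) (U (.add (V 16) (V 12))))))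

/-- Gram-Schmidt orthogonalization of the rows of the matrix. -/
def orthogonalize : Program :=
  .setNat (.const 15) (.const 0) ;;
  forLoop 10 (V 6) (
    .setNat (.const 16) (.const 0) ;;
    forLoop 11 (V 10) (
      reduceRow ;;
      incr 16 (V 3)) ;;
    incr 15 (V 3))

/-- Append the point of the block at `15`. -/
def emitPoint : Program :=
  forLoop 11 (V 0) (
    .setReal (arr 2 (.const 0)) (.const 0) ;;
    .setNat (.const 13) (V 11) ;;
    forLoop 14 (V 1) (
      .setReal (arr 2 (.const 0))
        (.add (R 0) (.mul (U (.add (V 15) (V 14))) (.mem (V 13)))) ;;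
      incr 13 (V 0)) ;;
    .setReal (arr 0 (V 7)) (.div (R 0) (U (V 16))) ;;
    incr 7 (.const 1)) ;;
  incr 8 (.const 1)

/-- Append the points given by the blocks of the last row of the matrix to the output list. -/
def emitPoints : Program :=
  .setNat (.const 15) (.sub (V 15) (V 3)) ;;
  .setNat (.const 16) (.add (V 15) (V 2)) ;;
  forLoop 10 (V 0) (
    .setNat (.const 12) (.const 0) ;;
    .ite (.realLt (.const 0) (U (V 16))) (.setNat (.const 12) (.const 1)) .skip ;;
    forLoop 11 (V 1) (
      .ite (.realLt (U (.add (V 15) (V 11))) (.const 0)) (.setNat (.const 12) (.const 0)) .skip) ;;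
    .ite (.natEq (V 12) (.const 1))
      emitPoint .skip ;;
    incr 15 (V 1))

/-- Increase the number given by the digits; `9` tells whether there is an overflow. -/
def nextDigits : Program :=
  .setNat (.const 9) (.const 1) ;;
  forLoop 10 (V 5) (
    .ite (.natEq (V 9) (.const 1))
      (.ite (.natLt (.add (G (V 10)) (.const 1)) (V 2))
        (.setNat (.add (.const 64) (V 10)) (.add (G (V 10)) (.const 1)) ;;
          .setNat (.const 9) (.const 0))
        (.setNat (.add (.const 64) (V 10)) (.const 0)))
      .skip)

/-- Compute the sizes. -/
def initSizes : Program :=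
  forLoop 10 (V 0) (incr 2 (V 1)) ;;
  forLoop 10 (V 0) (incr 4 (V 0)) ;;
  .setNat (.const 3) (.add (V 2) (.const 1)) ;;
  .setNat (.const 6) (.add (.add (V 2) (V 0)) (.add (V 4) (.const 1))) ;;
  .setNat (.const 5) (.add (.sub (V 4) (.const 1)) (V 4)) ;;
  .setNat (.const 4) (.sub (V 4) (.const 1))

/-- The list of all points found is moved to its final place, behind the input. -/
def moveOutput : Program :=
  forLoop 10 (V 7) (.setReal (.add (V 2) (V 10)) (.mem (arr 0 (V 10)))) ;;
  .setNat (.const 0) (.add (V 1) (V 8))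

/-- The algorithm. -/
def closureProgram : Program :=
  initSizes ;;
  .loop (.natEq (V 9) (.const 0)) (emitMatrix ;; orthogonalize ;; emitPoints ;; nextDigits) ;;
  moveOutput

/-! ### Evaluation -/

section
variable {N : ℕ} {M : Mem}

theorem eval_nconst (c : ℕ) (σ : State) : (NatExpr.const c).eval σ = c := rfl
theorem eval_nadd (a b : NatExpr) (σ : State) : (a.add b).eval σ = a.eval σ + b.eval σ := rfl
theorem eval_nsub (a b : NatExpr) (σ : State) : (a.sub b).eval σ = a.eval σ - b.eval σ := rfl
theorem eval_rconst (c : ℚ) (σ : State) : (RealExpr.const c).eval σ = c := rfl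
theorem eval_radd (a b : RealExpr) (σ : State) : (a.add b).eval σ = a.eval σ + b.eval σ := rfl
theorem eval_rsub (a b : RealExpr) (σ : State) : (a.sub b).eval σ = a.eval σ - b.eval σ := rfl
theorem eval_rmul (a b : RealExpr) (σ : State) : (a.mul b).eval σ = a.eval σ * b.eval σ := rfl
theorem eval_rdiv (a b : RealExpr) (σ : State) : (a.div b).eval σ = a.eval σ / b.eval σ := rfl

end

/-- The sizes have been computed. -/
structure Ready (n m : ℕ) (M : Mem) : Prop where
  v0 : M.v 0 = n
  v1 : M.v 1 = m
  v2 : M.v 2 = n * m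
  v3 : M.v 3 = n * m + 1
  v4 : M.v 4 = n * n - 1
  v5 : M.v 5 = n * n - 1 + n * n
  v6 : M.v 6 = n * m + n + n * n + 1

theorem Ready.congr {n m : ℕ} {M M' : Mem} (h : Ready n m M) (h' : ∀ y < 7, M'.v y = M.v y) :
    Ready n m M' := by
  obtain ⟨h0, h1, h2, h3, h4, h5, h6⟩ := h
  constructor <;> rw [h' _ (by norm_num)] <;> assumption

/-- The memories agree in the array of naturals, in the input and in the output. -/
structure Same (M M' : Mem) : Prop where
  g : M'.g = M.g
  s : M'.s = M.s
  o : M'.o = M.o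
  v : ∀ y < 10, M'.v y = M.v y

theorem Same.refl (M : Mem) : Same M M := ⟨rfl, rfl, rfl, fun _ _ => rfl⟩

theorem Same.trans {M M' M'' : Mem} (h : Same M M') (h' : Same M' M'') : Same M M'' :=
  ⟨h'.g.trans h.g, h'.s.trans h.s, h'.o.trans h.o, fun y hy => (h'.v y hy).trans (h.v y hy)⟩

theorem Same.ready {n m : ℕ} {M M' : Mem} (h : Same M M') (hM : Ready n m M) : Ready n m M' :=
  hM.congr fun y hy => h.v y (by omega)

theorem Same.setV {M M' : Mem} (h : Same M M') {x k : ℕ} (hx : 10 ≤ x) :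
    Same M { M' with v := Function.update M'.v x k } :=
  ⟨h.g, h.s, h.o, fun y hy => by simp [show y ≠ x by omega, h.v y hy]⟩

theorem Same.emit {M M' : Mem} (h : Same M M') {p : ℕ} {u' : ℕ → ℝ} :
    Same M { M' with u := u', v := Function.update M'.v 20 p } :=
  ⟨h.g, h.s, h.o, (h.setV (by norm_num)).v⟩

/-! ### The matrix -/

/-- The first `p` entries of `E` have been written. -/
structure Emitted (E : ℕ → ℝ) (p : ℕ) (M : Mem) : Prop where
  v : M.v 20 = p
  u : ∀ w < p, M.u w = E w

theorem Emitted.setV {E : ℕ → ℝ} {p : ℕ} {M : Mem} (h : Emitted E p M) {x k : ℕ} (hx : x ≠ 20) :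
    Emitted E p { M with v := Function.update M.v x k } :=
  ⟨by simp [hx.symm, h.v], h.u⟩

theorem Emitted.setR {E : ℕ → ℝ} {p : ℕ} {M : Mem} (h : Emitted E p M) (r' : ℕ → ℝ) :
    Emitted E p { M with r := r' } := ⟨h.v, h.u⟩

theorem Runs.incr {Z N x : ℕ} {e : NatExpr} {M : Mem} {Q : Mem → Prop} (hx : x < 64)
    (h : Q { M with v := Function.update M.v x (M.v x + e.eval (enc N M)) }) :
    Runs Z N (incr x e) M Q := by
  refine Runs.setV hx ?_
  rwa [eval_nadd, eval_V hx]

theorem Runs.emit {Z N p : ℕ} {E : ℕ → ℝ} {e : RealExpr} {M : Mem} {Q : Mem → Prop}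
    (hN : M.v 2 = N) (hE : Emitted E p M) (he : e.eval (enc N M) = E p)
    (h : ∀ u', Emitted E (p + 1) { M with u := u', v := Function.update M.v 20 (p + 1) } →
      Q { M with u := u', v := Function.update M.v 20 (p + 1) }) :
    Runs Z N (emit e) M Q := by
  refine Runs.seq (Runs.setU hN (Runs.incr (by norm_num) ?_))
  rw [eval_V (by norm_num), eval_nconst]
  simp only [hE.v, he]
  refine h _ ⟨by simp, fun w hw => ?_⟩
  by_cases hwp : w = p
  · simp [hwp]
  · simp [hwp, hE.u w (by omega)]

/-- For loops whose rounds write exactly `w` entries each, so that the write position follows from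
the round. By `hJ` the side invariant is insensitive to the counter. -/
theorem Runs.forEmit {Z N x a w : ℕ} {e : NatExpr} {p : Program} {E : ℕ → ℝ} {M : Mem}
    {Q : Mem → Prop} (J : ℕ → Mem → Prop) (K : ℕ) (hx : x < 64) (hx' : x ≠ 20) (hK : K ≤ Z)
    (hJ : ∀ k M y, J k M → J k { M with v := Function.update M.v x y })
    (he : ∀ k ≤ K, ∀ M, J k M → e.eval (enc N M) = K)
    (step : ∀ k < K, ∀ M, J k M → M.v x = k → Emitted E (a + k * w) M → Runs Z N p M fun M' =>
      M'.v x = k ∧ J (k + 1) M' ∧ Emitted E (a + (k + 1) * w) M')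
    (h0 : J 0 M) (hM : Emitted E a M) (last : ∀ M', J K M' → Emitted E (a + K * w) M' → Q M') :
    Runs Z N (RealRAM.forLoop x e p) M Q := by
  refine Runs.forLoop (fun k M' => J k M' ∧ Emitted E (a + k * w) M') K hx hK ?_ ?_ ?_ ?_
  · exact ⟨hJ _ _ _ h0, by simpa using hM.setV hx'⟩
  · exact fun k hk M' _ h => he k hk M' h.1
  · rintro k hk M' hxk ⟨h, h'⟩
    refine (step k hk M' h hxk h').mono ?_
    rintro M'' ⟨h1, h2, h3⟩
    exact ⟨h1, hJ _ _ _ h2, h3.setV hx'⟩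
  · exact fun M' _ h => last M' h.1 h.2

/-- The matrix of the homogeneous linear system belonging to the digits `g`. -/
noncomputable def sysRow (n m : ℕ) (s : ℕ → ℝ) (g : ℕ → ℕ) (k d : ℕ) : ℝ :=
  if k < n * m then (if d = k ∧ ∀ l < n * n - 1, g l ≠ k then 1 else 0)
  else if k < n * m + n then
    (if d < n * m then (if d / m = k - n * m then 1 else 0) else -1)
  else if k < n * m + n + n * n then
    (if d < n * m ∧ g (n * n - 1 + (k - (n * m + n))) = 0 then
      (if d / m = (k - (n * m + n)) % n then s ((k - (n * m + n)) / n + d % m * n) else 0) -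
      (if d / m = (k - (n * m + n)) / n then s ((k - (n * m + n)) / n + d % m * n) else 0)
    else 0)
  else if d = n * m then 1 else 0

/-- The entries of the matrix, row by row. -/
noncomputable def sysEntry (n m : ℕ) (s : ℕ → ℝ) (g : ℕ → ℕ) (w : ℕ) : ℝ :=
  sysRow n m s g (w / (n * m + 1)) (w % (n * m + 1))

theorem sysEntry_add (n m : ℕ) (s : ℕ → ℝ) (g : ℕ → ℕ) (k d : ℕ) (hd : d < n * m + 1) :
    sysEntry n m s g (k * (n * m + 1) + d) = sysRow n m s g k d := by
  rw [sysEntry, mul_comm k, Nat.mul_add_div (by omega), Nat.mul_add_mod, Nat.div_eq_of_lt hd,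
    Nat.mod_eq_of_lt hd, add_zero]

section
variable {n m Z : ℕ} {M₀ : Mem}

/-- A unit row forces a weight outside the support to vanish. Weights in the support get a zero row,
so the matrix has the same shape for all digits. -/
theorem runs_emitSupport (hZ : n * m + n * n ≤ Z) (hM₀ : Ready n m M₀) {M : Mem} {Q : Mem → Prop}
    (hM : Same M₀ M) (hE : Emitted (sysEntry n m M₀.s M₀.g) 0 M)
    (hQ : ∀ M', Same M₀ M' →
      Emitted (sysEntry n m M₀.s M₀.g) (n * m * (n * m + 1)) M' → Q M') :
    Runs Z (n * m) emitSupport M Q := by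
  refine Runs.forEmit (fun _ M' => Same M₀ M') (n * m) (w := n * m + 1) (by norm_num)
    (by norm_num) (by omega) (fun k M y h => h.setV (by norm_num)) ?_ ?_ hM hE (by simpa using hQ)
  · intro k _ M' h
    rw [eval_V (by norm_num), (h.ready hM₀).v2]
  intro c hc M1 h1 hc1 hE1
  refine Runs.seq (Runs.setV (by norm_num) (Runs.seq ?_))
  rw [eval_nconst]
  -- the search
  refine Runs.forLoop (fun k M' => Same M₀ M' ∧ M'.v 10 = c ∧
    Emitted (sysEntry n m M₀.s M₀.g) (0 + c * (n * m + 1)) M' ∧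
    M'.v 12 = if ∀ l < k, M₀.g l ≠ c then 1 else 0) (n * n - 1) (by norm_num) (by omega) ?_ ?_ ?_ ?_
  · exact ⟨(h1.setV (by norm_num)).setV (by norm_num), by simp [hc1],
      (hE1.setV (by norm_num)).setV (by norm_num), by simp⟩
  · rintro k hk M' - ⟨h, -⟩
    rw [eval_V (by norm_num), (h.ready hM₀).v4]
  · rintro k hk M' hk' ⟨h, hc', hE', hf⟩
    refine Runs.ite (fun hb => Runs.setV (by norm_num) ?_) (fun hb => Runs.skip ?_)
    · simp only [Test.Holds] at hb
      rw [eval_G, eval_V (by norm_num), eval_V (by norm_num), hc', hk', h.g] at hb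
      refine ⟨by simp [hk'], (h.setV (by norm_num)).setV (by norm_num), by simp [hc'],
        (hE'.setV (by norm_num)).setV (by norm_num), ?_⟩
      rw [if_neg (fun hh => hh k (Nat.lt_succ_self k) hb)]
      simp [eval_nconst]
    · simp only [Test.Holds] at hb
      rw [eval_G, eval_V (by norm_num), eval_V (by norm_num), hc', hk', h.g] at hb
      refine ⟨hk', h.setV (by norm_num), by simp [hc'], hE'.setV (by norm_num), ?_⟩
      simp only [Function.update_apply]
      rw [if_neg (by norm_num), hf]
      congr 1
      rw [Nat.forall_lt_succ_right]
      simp [hb]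
  rintro M2 - ⟨h2, hc2, hE2, hf2⟩
  refine Runs.seq ?_
  refine Runs.forEmit (fun _ M' => Same M₀ M' ∧ M'.v 10 = c ∧
    M'.v 12 = if ∀ l < n * n - 1, M₀.g l ≠ c then 1 else 0) (n * m) (w := 1) (by norm_num)
    (by norm_num) (by omega) ?_ ?_ ?_ ⟨h2, hc2, hf2⟩ hE2 ?_
  · rintro k M' y ⟨h, h', h''⟩
    exact ⟨h.setV (by norm_num), by simp [h'], by simp [h'']⟩
  · rintro k _ M' ⟨h, -⟩
    rw [eval_V (by norm_num), (h.ready hM₀).v2]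
  · rintro d hd M' ⟨h, hc', hf⟩ hd' hE'
    rw [zero_add, mul_one] at hE'
    have hval := sysEntry_add n m M₀.s M₀.g c d (by omega)
    rw [sysRow, if_pos hc] at hval
    have hpost : ∀ u', Emitted (sysEntry n m M₀.s M₀.g) (c * (n * m + 1) + d + 1)
        { M' with u := u', v := Function.update M'.v 20 (c * (n * m + 1) + d + 1) } →
        (Function.update M'.v 20 (c * (n * m + 1) + d + 1) 11 = d ∧
        (Same M₀ { M' with u := u', v := Function.update M'.v 20 (c * (n * m + 1) + d + 1) } ∧
          Function.update M'.v 20 (c * (n * m + 1) + d + 1) 10 = c ∧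
          Function.update M'.v 20 (c * (n * m + 1) + d + 1) 12 =
            if ∀ l < n * n - 1, M₀.g l ≠ c then 1 else 0) ∧
        Emitted (sysEntry n m M₀.s M₀.g) (0 + c * (n * m + 1) + (d + 1) * 1)
        { M' with u := u', v := Function.update M'.v 20 (c * (n * m + 1) + d + 1) }) := by
      intro u' hu'
      refine ⟨by simp [hd'], ⟨h.emit, by simp [hc'],
        by simp [hf]⟩, ?_⟩
      rw [zero_add, mul_one, ← add_assoc]; exact hu'
    refine Runs.ite (fun hb => Runs.emit (h.ready hM₀).v2 hE' ?_ hpost)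
      (fun hb => Runs.emit (h.ready hM₀).v2 hE' ?_ hpost)
    · simp only [Test.Holds] at hb
      rw [eval_V (by norm_num), eval_V (by norm_num), eval_V (by norm_num), hc', hd', hf,
        eval_nconst] at hb
      rw [hval, if_pos]
      · simp [eval_rconst]
      · refine ⟨hb.1, ?_⟩
        by_contra hh
        rw [if_neg hh] at hb
        exact absurd hb.2 (by norm_num)
    · simp only [Test.Holds] at hb
      rw [eval_V (by norm_num), eval_V (by norm_num), eval_V (by norm_num), hc', hd', hf,
        eval_nconst] at hb
      rw [hval, if_neg]
      · simp [eval_rconst]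
      · rintro ⟨hh, hh'⟩
        exact hb ⟨hh, by rw [if_pos hh']⟩
  rintro M3 ⟨h3, hc3, hf3⟩ hE3
  rw [zero_add, mul_one] at hE3
  refine Runs.emit (h3.ready hM₀).v2 hE3 ?_ ?_
  · rw [sysEntry_add _ _ _ _ _ _ (by omega), sysRow, if_pos hc, if_neg (fun hh => by omega)]
    simp [eval_rconst]
  · intro u' hu'
    refine ⟨by simp [hc3], h3.emit, ?_⟩
    convert hu' using 1
    ring

end

end RealRAM

/-! ### The rows for equal sums and for tight constraints -/

namespace RealRAM

section
variable {n m Z : ℕ} {M₀ : Mem}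

theorem mul_add_lt_mul {a b n m : ℕ} (ha : a < n) (hb : b < m) : a * m + b < n * m :=
  calc a * m + b < a * m + m := by omega
    _ = (a + 1) * m := by ring
    _ ≤ n * m := Nat.mul_le_mul_right m ha

theorem mul_add_div_eq {b j m : ℕ} (hj : j < m) : (b * m + j) / m = b := by
  rw [mul_comm, Nat.mul_add_div (by omega), Nat.div_eq_of_lt hj, add_zero]

theorem mul_add_mod_eq {b j m : ℕ} (hj : j < m) : (b * m + j) % m = j := by
  rw [mul_comm, Nat.mul_add_mod, Nat.mod_eq_of_lt hj]

theorem sysRow_sum {s : ℕ → ℝ} {g : ℕ → ℕ} {a b j : ℕ} (ha : a < n) (hb : b < n) (hj : j < m) :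
    sysRow n m s g (n * m + a) (b * m + j) = if b = a then 1 else 0 := by
  rw [sysRow, if_neg (by omega), if_pos (by omega), if_pos (mul_add_lt_mul hb hj),
    mul_add_div_eq hj, Nat.add_sub_cancel_left]

theorem sysRow_sum_last {s : ℕ → ℝ} {g : ℕ → ℕ} {a : ℕ} (ha : a < n) :
    sysRow n m s g (n * m + a) (n * m) = -1 := by
  rw [sysRow, if_neg (by omega), if_pos (by omega), if_neg (lt_irrefl _)]

theorem sysRow_tight {s : ℕ → ℝ} {g : ℕ → ℕ} {i b a j : ℕ} (hi : i < n) (hb : b < n) (ha : a < n)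
    (hj : j < m) : sysRow n m s g (n * m + n + (i * n + b)) (a * m + j) =
      if g (n * n - 1 + (i * n + b)) = 0 then
        (if a = b then s (i + j * n) else 0) - (if a = i then s (i + j * n) else 0) else 0 := by
  have := mul_add_lt_mul hi hb
  rw [sysRow, if_neg (by omega), if_neg (by omega), if_pos (by omega), Nat.add_sub_cancel_left,
    mul_add_div_eq hj, mul_add_mod_eq hj, mul_add_div_eq hb, mul_add_mod_eq hb]
  simp only [mul_add_lt_mul ha hj, true_and]

theorem sysRow_tight_last {s : ℕ → ℝ} {g : ℕ → ℕ} {i b : ℕ} (hi : i < n) (hb : b < n) :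
    sysRow n m s g (n * m + n + (i * n + b)) (n * m) = 0 := by
  have := mul_add_lt_mul hi hb
  rw [sysRow, if_neg (by omega), if_neg (by omega), if_pos (by omega), if_neg (by omega)]

theorem sysRow_last {s : ℕ → ℝ} {g : ℕ → ℕ} {d : ℕ} :
    sysRow n m s g (n * m + n + n * n) d = if d = n * m then 1 else 0 := by
  rw [sysRow, if_neg (by omega), if_neg (by omega), if_neg (by omega)]

theorem runs_emitSums (hZ : n + m ≤ Z) (hM₀ : Ready n m M₀) {M : Mem} {Q : Mem → Prop}
    (hM : Same M₀ M) (hE : Emitted (sysEntry n m M₀.s M₀.g) (n * m * (n * m + 1)) M)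
    (hQ : ∀ M', Same M₀ M' →
      Emitted (sysEntry n m M₀.s M₀.g) ((n * m + n) * (n * m + 1)) M' → Q M') :
    Runs Z (n * m) emitSums M Q := by
  refine Runs.forEmit (fun _ M' => Same M₀ M') n (w := n * m + 1) (by norm_num)
    (by norm_num) (by omega) (fun k M y h => h.setV (by norm_num)) ?_ ?_ hM hE
    (fun M' h h' => hQ M' h (by rwa [add_mul]))
  · intro k _ M' h
    rw [eval_V (by norm_num), (h.ready hM₀).v0]
  intro a ha M1 h1 ha1 hE1
  refine Runs.seq ?_
  refine Runs.forEmit (fun _ M' => Same M₀ M' ∧ M'.v 10 = a) n (w := m) (by norm_num)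
    (by norm_num) (by omega) ?_ ?_ ?_ ⟨h1, ha1⟩ hE1 ?_
  · rintro k M' y ⟨h, h'⟩
    exact ⟨h.setV (by norm_num), by simp [h']⟩
  · rintro k _ M' ⟨h, -⟩
    rw [eval_V (by norm_num), (h.ready hM₀).v0]
  · rintro b hb M2 ⟨h2, ha2⟩ hb2 hE2
    refine Runs.forEmit (fun _ M' => Same M₀ M' ∧ M'.v 10 = a ∧ M'.v 11 = b) m (w := 1)
      (by norm_num) (by norm_num) (by omega) ?_ ?_ ?_ ⟨h2, ha2, hb2⟩ hE2 ?_
    · rintro k M' y ⟨h, h', h''⟩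
      exact ⟨h.setV (by norm_num), by simp [h'], by simp [h'']⟩
    · rintro k _ M' ⟨h, -⟩
      rw [eval_V (by norm_num), (h.ready hM₀).v1]
    · rintro j hj M3 ⟨h3, ha3, hb3⟩ hj3 hE3
      have hval := sysEntry_add n m M₀.s M₀.g (n * m + a) (b * m + j)
        ((mul_add_lt_mul hb hj).trans (Nat.lt_succ_self _))
      rw [sysRow_sum ha hb hj] at hval
      have hidx : n * m * (n * m + 1) + a * (n * m + 1) + b * m + j * 1 =
        (n * m + a) * (n * m + 1) + (b * m + j) := by ring
      have hpost : ∀ u' p, Emitted (sysEntry n m M₀.s M₀.g) (p + j * 1 + 1)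
          { M3 with u := u', v := Function.update M3.v 20 (p + j * 1 + 1) } →
          (Function.update M3.v 20 (p + j * 1 + 1) 12 = j ∧
          (Same M₀ { M3 with u := u', v := Function.update M3.v 20 (p + j * 1 + 1) } ∧
            Function.update M3.v 20 (p + j * 1 + 1) 10 = a ∧
            Function.update M3.v 20 (p + j * 1 + 1) 11 = b) ∧
          Emitted (sysEntry n m M₀.s M₀.g) (p + (j + 1) * 1)
          { M3 with u := u', v := Function.update M3.v 20 (p + j * 1 + 1) }) := by
        intro u' p hu'
        exact ⟨by simp [hj3], ⟨h3.emit, by simp [ha3], by simp [hb3]⟩, hu'⟩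
      refine Runs.ite (fun hc => Runs.emit (h3.ready hM₀).v2 hE3 ?_ fun u' => hpost u' _)
        (fun hc => Runs.emit (h3.ready hM₀).v2 hE3 ?_ fun u' => hpost u' _)
      all_goals
        simp only [Test.Holds] at hc
        rw [eval_V (by norm_num), eval_V (by norm_num), ha3, hb3] at hc
        rw [hidx, hval]
        simp [eval_rconst, hc]
    · rintro M3 ⟨h3, ha3, hb3⟩ hE3
      refine ⟨hb3, ⟨h3, ha3⟩, ?_⟩
      convert hE3 using 1
      ring
  · rintro M2 ⟨h2, ha2⟩ hE2
    refine Runs.emit (h2.ready hM₀).v2 hE2 ?_ fun u' hu' => ⟨by simp [ha2], h2.emit, ?_⟩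
    · have hidx : n * m * (n * m + 1) + a * (n * m + 1) + n * m =
        (n * m + a) * (n * m + 1) + n * m := by ring
      rw [hidx, sysEntry_add _ _ _ _ _ _ (by omega), sysRow_sum_last ha]
      simp [eval_rconst]
    · convert hu' using 1
      ring

/-- The contributions of block `b` (plus) and block `i` (minus) are accumulated by separate tests,
so that they cancel for `b = i`. A nonzero digit gives a zero row. -/
theorem runs_emitTight (hZ : n + m ≤ Z) (hM₀ : Ready n m M₀) {M : Mem} {Q : Mem → Prop}
    (hM : Same M₀ M) (hE : Emitted (sysEntry n m M₀.s M₀.g) ((n * m + n) * (n * m + 1)) M)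
    (hQ : ∀ M', Same M₀ M' →
      Emitted (sysEntry n m M₀.s M₀.g) ((n * m + n + n * n) * (n * m + 1)) M' → Q M') :
    Runs Z (n * m) emitTight M Q := by
  refine Runs.seq (Runs.setV (by norm_num) ?_)
  rw [eval_V (by norm_num), (hM.ready hM₀).v4]
  refine Runs.forEmit (fun i M' => Same M₀ M' ∧ M'.v 21 = n * n - 1 + i * n) n
    (w := n * (n * m + 1)) (by norm_num) (by norm_num) (by omega) ?_ ?_ ?_
    ⟨hM.setV (by norm_num), by simp⟩ (hE.setV (by norm_num)) ?_
  · rintro k M' y ⟨h, h'⟩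
    exact ⟨h.setV (by norm_num), by simp [h']⟩
  · rintro k _ M' ⟨h, -⟩
    rw [eval_V (by norm_num), (h.ready hM₀).v0]
  · rintro i hi M1 ⟨h1, hp1⟩ hi1 hE1
    refine Runs.forEmit (fun b M' => Same M₀ M' ∧ M'.v 21 = n * n - 1 + (i * n + b) ∧
      M'.v 10 = i) n (w := n * m + 1) (by norm_num) (by norm_num) (by omega) ?_ ?_ ?_
      ⟨h1, by simp [hp1], hi1⟩ hE1 ?_
    · rintro k M' y ⟨h, h', h''⟩
      exact ⟨h.setV (by norm_num), by simp [h'], by simp [h'']⟩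
    · rintro k _ M' ⟨h, -⟩
      rw [eval_V (by norm_num), (h.ready hM₀).v0]
    · rintro b hb M2 ⟨h2, hp2, hi2⟩ hb2 hE2
      have hib := mul_add_lt_mul hi hb
      refine Runs.seq ?_
      refine Runs.forEmit (fun _ M' => Same M₀ M' ∧ M'.v 21 = n * n - 1 + (i * n + b) ∧
        M'.v 10 = i ∧ M'.v 11 = b) n (w := m) (by norm_num) (by norm_num) (by omega) ?_ ?_ ?_
        ⟨h2, hp2, hi2, hb2⟩ hE2 ?_
      · rintro k M' y ⟨h, h', h'', h3⟩
        exact ⟨h.setV (by norm_num), by simp [h'], by simp [h''], by simp [h3]⟩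
      · rintro k _ M' ⟨h, -⟩
        rw [eval_V (by norm_num), (h.ready hM₀).v0]
      · rintro a ha M3 ⟨h3, hp3, hi3, hb3⟩ ha3 hE3
        refine Runs.seq (Runs.setV (by norm_num) ?_)
        rw [eval_V (by norm_num), hi3]
        refine Runs.forEmit (fun j M' => Same M₀ M' ∧ M'.v 21 = n * n - 1 + (i * n + b) ∧
          M'.v 10 = i ∧ M'.v 11 = b ∧ M'.v 12 = a ∧ M'.v 13 = i + j * n) m (w := 1)
          (by norm_num) (by norm_num) (by omega) ?_ ?_ ?_
          ⟨h3.setV (by norm_num), by simp [hp3], by simp [hi3], by simp [hb3], by simp [ha3],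
            by simp⟩ (hE3.setV (by norm_num)) ?_
        · rintro k M' y ⟨h, h', h'', h3, h4, h5⟩
          exact ⟨h.setV (by norm_num), by simp [h'], by simp [h''], by simp [h3], by simp [h4],
            by simp [h5]⟩
        · rintro k _ M' ⟨h, -⟩
          rw [eval_V (by norm_num), (h.ready hM₀).v1]
        · rintro j hj M4 ⟨h4, hp4, hi4, hb4, ha4, hq4⟩ hj4 hE4
          have hval := sysEntry_add n m M₀.s M₀.g (n * m + n + (i * n + b)) (a * m + j)
            ((mul_add_lt_mul ha hj).trans (Nat.lt_succ_self _))
          rw [sysRow_tight hi hb ha hj] at hval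
          have hidx : (n * m + n) * (n * m + 1) + i * (n * (n * m + 1)) + b * (n * m + 1) + a * m +
            j * 1 = (n * m + n + (i * n + b)) * (n * m + 1) + (a * m + j) := by ring
          have hN := (h4.ready hM₀).v2
          -- The address stays within the input cells, where the layout is the identity; hence a
          -- plain memory access reads the coordinate.
          have hq : i + j * n < n * m := by
            have := mul_add_lt_mul hj hi
            rw [mul_comm m] at this
            omega
          have hs : ∀ M' : Mem, M'.v = M4.v → M'.s = M4.s →
              (RealExpr.mem (V 13)).eval (enc (n * m) M') = M₀.s (i + j * n) := by
            intro M' hv hs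
            rw [eval_s, eval_V (by norm_num), hv, hq4, hs, h4.s]
            rwa [eval_V (by norm_num), hv, hq4]
          have hr : ∀ M' : Mem, M'.v = M4.v → (R 0).eval (enc (n * m) M') = M'.r 0 :=
            fun M' hv => eval_r (by rw [hv, hN]) _
          refine Runs.seq (Runs.setR hN (Runs.seq ?_))
          refine Runs.mono (Q' := fun M' => ∃ r', M' = { M4 with r := r' } ∧
            r' 0 = sysEntry n m M₀.s M₀.g
              ((n * m + n + (i * n + b)) * (n * m + 1) + (a * m + j))) ?_ ?_
          · refine Runs.ite (fun hc => Runs.seq ?_) (fun hc => Runs.skip ?_)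
            all_goals
              simp only [Test.Holds] at hc
              rw [eval_G, eval_V (by norm_num)] at hc
              simp only [eval_nconst, hp4, h4.g] at hc
              rw [hval]
              simp only [hc, if_true, if_false]
            · refine Runs.mono (Q' := fun M' => ∃ r', M' = { M4 with r := r' } ∧
                r' 0 = if a = b then M₀.s (i + j * n) else 0) ?_ ?_
              · refine Runs.ite (fun hc' => Runs.setR hN ?_) (fun hc' => Runs.skip ?_)
                all_goals
                  simp only [Test.Holds] at hc'
                  rw [eval_V (by norm_num), eval_V (by norm_num)] at hc'
                  simp only [ha4, hb4] at hc'
                  refine ⟨_, rfl, ?_⟩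
                · rw [eval_radd, hs, hr]
                  · simp [hc', eval_rconst, eval_nconst]
                  all_goals rfl
                · simp [hc', eval_rconst, eval_nconst]
              · rintro M' ⟨r', rfl, hr'⟩
                refine Runs.ite (fun hc' => Runs.setR hN ?_) (fun hc' => Runs.skip ?_)
                all_goals
                  simp only [Test.Holds] at hc'
                  rw [eval_V (by norm_num), eval_V (by norm_num)] at hc'
                  simp only [ha4, hi4] at hc'
                  refine ⟨_, rfl, ?_⟩
                · rw [eval_rsub, hs, hr]
                  · simp [hc', hr', eval_nconst]
                  all_goals rfl
                · simp [hc', hr']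
            · exact ⟨_, rfl, by simp [eval_nconst, eval_rconst]⟩
          · rintro M' ⟨r', rfl, hr'⟩
            refine Runs.seq (Runs.emit (E := sysEntry n m M₀.s M₀.g) hN (hE4.setR r') ?_ ?_)
            · rw [eval_r (M := { M4 with r := r' }) hN, eval_nconst, hidx]
              exact hr'
            · intro u' hu'
              refine Runs.incr (by norm_num) ?_
              rw [eval_V (by norm_num)]
              refine ⟨by simp [hj4], ⟨?_, by simp [hp4], by simp [hi4], by simp [hb4],
                by simp [ha4], ?_⟩, ?_⟩
              · have h5 : Same M₀ { M4 with r := r' } := ⟨h4.g, h4.s, h4.o, h4.v⟩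
                exact (h5.emit (p := _) (u' := u')).setV (by norm_num)
              · simp [hq4, (h4.ready hM₀).v0]
                ring
              · convert hu'.setV (x := 13) (by norm_num) using 1
                ring
        · rintro M4 ⟨h4, hp4, hi4, hb4, ha4, hq4⟩ hE4
          refine ⟨ha4, ⟨h4, hp4, hi4, hb4⟩, ?_⟩
          convert hE4 using 1
          ring
      · rintro M3 ⟨h3, hp3, hi3, hb3⟩ hE3
        refine Runs.seq (Runs.emit (h3.ready hM₀).v2 hE3 ?_ ?_)
        · have hidx : (n * m + n) * (n * m + 1) + i * (n * (n * m + 1)) + b * (n * m + 1) + n * m =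
            (n * m + n + (i * n + b)) * (n * m + 1) + n * m := by ring
          rw [hidx, sysEntry_add _ _ _ _ _ _ (by omega), sysRow_tight_last hi hb]
          simp [eval_rconst]
        · intro u' hu'
          refine Runs.incr (by norm_num) ?_
          rw [eval_nconst]
          refine ⟨by simp [hb3], ⟨h3.emit.setV (by norm_num), by simp [hp3]; ring, by simp [hi3]⟩,
            ?_⟩
          convert hu'.setV (x := 21) (by norm_num) using 1
          ring
    · rintro M2 ⟨h2, hp2, hi2⟩ hE2
      refine ⟨hi2, ⟨h2, by rw [hp2]; ring⟩, ?_⟩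
      convert hE2 using 1
      ring
  · rintro M' ⟨h, -⟩ hE'
    refine hQ M' h ?_
    convert hE' using 1
    ring

theorem runs_emitLast (hZ : n * m ≤ Z) (hM₀ : Ready n m M₀) {M : Mem} {Q : Mem → Prop}
    (hM : Same M₀ M) (hE : Emitted (sysEntry n m M₀.s M₀.g) ((n * m + n + n * n) * (n * m + 1)) M)
    (hQ : ∀ M', Same M₀ M' →
      Emitted (sysEntry n m M₀.s M₀.g) ((n * m + n + n * n + 1) * (n * m + 1)) M' → Q M') :
    Runs Z (n * m) emitLast M Q := by
  refine Runs.seq (Runs.forEmit (fun _ M' => Same M₀ M') (n * m) (w := 1) (by norm_num)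
    (by norm_num) hZ (fun k M y h => h.setV (by norm_num)) ?_ ?_ hM hE ?_)
  · intro k _ M' h
    rw [eval_V (by norm_num), (h.ready hM₀).v2]
  · intro d hd M1 h1 hd1 hE1
    refine Runs.emit (h1.ready hM₀).v2 hE1 ?_ fun u' hu' => ⟨by simp [hd1], h1.emit, hu'⟩
    rw [mul_one, sysEntry_add _ _ _ _ _ _ (by omega), sysRow_last, if_neg (by omega)]
    simp [eval_rconst]
  · intro M1 h1 hE1
    refine Runs.emit (h1.ready hM₀).v2 hE1 ?_ fun u' hu' => hQ _ h1.emit ?_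
    · rw [mul_one, sysEntry_add _ _ _ _ _ _ (by omega), sysRow_last, if_pos rfl]
      simp [eval_rconst]
    · convert hu' using 1
      ring

/-- The matrix is written correctly. -/
theorem runs_emitMatrix (hZ : n * m + n * n + n + m ≤ Z) (hM₀ : Ready n m M₀) {Q : Mem → Prop}
    (hQ : ∀ M', Same M₀ M' → (∀ k < n * m + n + n * n + 1, ∀ d < n * m + 1,
      M'.u (k * (n * m + 1) + d) = sysRow n m M₀.s M₀.g k d) → Q M') :
    Runs Z (n * m) emitMatrix M₀ Q := by
  refine Runs.seq (Runs.setV (by norm_num) (Runs.seq (runs_emitSupport (by omega) hM₀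
    ((Same.refl _).setV (by norm_num)) ⟨by simp [eval_nconst], by simp⟩ fun M1 h1 hE1 =>
    Runs.seq (runs_emitSums (by omega) hM₀ h1 hE1 fun M2 h2 hE2 =>
    Runs.seq (runs_emitTight (by omega) hM₀ h2 hE2 fun M3 h3 hE3 =>
    runs_emitLast (by omega) hM₀ h3 hE3 fun M4 h4 hE4 => hQ M4 h4 ?_)))))
  intro k hk d hd
  rw [hE4.u _ (mul_add_lt_mul hk hd), sysEntry_add _ _ _ _ _ _ hd]

end

end RealRAM

/-! ### Gram–Schmidt orthogonalization -/

namespace RealRAM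

section
variable {n m Z : ℕ} {M₀ : Mem}

/-- A row of the matrix with `D` columns stored in the array `u`. -/
def rowOf (D : ℕ) (M : Mem) (l : ℕ) : Fin D → ℝ := fun d => M.u (l * D + d)

/-- One step of the orthogonalization: the row `k` is made orthogonal to the row `l`. -/
theorem runs_reduceRow {k l : ℕ} (hkl : k ≠ l) (hZ : n * m + 1 ≤ Z) {M : Mem} {Q : Mem → Prop}
    (hM : Ready n m M) (h15 : M.v 15 = k * (n * m + 1)) (h16 : M.v 16 = l * (n * m + 1))
    (hQ : ∀ M', Same M M' → (∀ y, y ≠ 12 → M'.v y = M.v y) →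
      (∀ j, j ≠ k → rowOf (n * m + 1) M' j = rowOf (n * m + 1) M j) →
      rowOf (n * m + 1) M' k = rowOf (n * m + 1) M k -
        ((rowOf (n * m + 1) M k ⬝ᵥ rowOf (n * m + 1) M l) /
          (rowOf (n * m + 1) M l ⬝ᵥ rowOf (n * m + 1) M l)) • rowOf (n * m + 1) M l → Q M') :
    Runs Z (n * m) reduceRow M Q := by
  set D := n * m + 1 with hD
  set x := rowOf D M k with hx
  set y := rowOf D M l with hy
  refine Runs.seq (Runs.setR hM.v2 (Runs.seq (Runs.setR hM.v2 (Runs.seq ?_))))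
  refine Runs.forLoop (fun d M' => M'.g = M.g ∧ M'.s = M.s ∧ M'.o = M.o ∧ M'.u = M.u ∧
    (∀ y, y ≠ 12 → M'.v y = M.v y) ∧
    M'.r 0 = ∑ e ∈ Finset.range d, M.u (k * D + e) * M.u (l * D + e) ∧
    M'.r 1 = ∑ e ∈ Finset.range d, M.u (l * D + e) * M.u (l * D + e)) D (by norm_num) hZ ?_ ?_ ?_ ?_
  · refine ⟨rfl, rfl, rfl, rfl, fun y hy => by simp [hy], ?_, ?_⟩ <;>
      simp [eval_nconst, eval_rconst]
  · rintro d - M' - ⟨-, -, -, -, h, -⟩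
    rw [eval_V (by norm_num), h _ (by norm_num), hM.v3]
  · rintro d hd M' hd' ⟨hg, hs, ho, hu, hv, h0, h1⟩
    have hN : M'.v 2 = n * m := by rw [hv _ (by norm_num), hM.v2]
    refine Runs.seq (Runs.setR hN (Runs.setR hN ⟨hd', hg, hs, ho, hu, ?_, ?_, ?_⟩))
    · intro y hy
      simp [hy, hv y hy]
    · simp only [eval_nconst, Function.update_apply]
      rw [if_neg (by norm_num), if_pos trivial, eval_radd, eval_rmul, eval_r hN, eval_u hN, eval_u hN,
        eval_nadd, eval_nadd, eval_nconst, eval_V (by norm_num), eval_V (by norm_num),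
        eval_V (by norm_num), hd', hv _ (by norm_num), hv _ (by norm_num), h15, h16, h0, hu,
        Finset.sum_range_succ]
    · simp only [eval_nconst, Function.update_apply, if_true]
      rw [eval_radd, eval_rmul, eval_r (by exact hN), eval_u (by exact hN), eval_nadd, eval_nconst,
        eval_V (by norm_num), eval_V (by norm_num), Finset.sum_range_succ, ← h1, hd',
        hv _ (by norm_num), h16, hu]
      simp
  rintro M1 - ⟨hg, hs, ho, hu, hv, h0, h1⟩
  have hN : M1.v 2 = n * m := by rw [hv _ (by norm_num), hM.v2]
  refine Runs.seq (Runs.setR hN ?_)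
  rw [eval_rdiv, eval_r hN, eval_r hN, eval_nconst, eval_nconst, h0, h1]
  have hxy : ∑ e ∈ Finset.range D, M.u (k * D + e) * M.u (l * D + e) = x ⬝ᵥ y := by
    rw [Finset.sum_range]; rfl
  have hyy : ∑ e ∈ Finset.range D, M.u (l * D + e) * M.u (l * D + e) = y ⬝ᵥ y := by
    rw [Finset.sum_range]; rfl
  rw [hxy, hyy]
  set c := x ⬝ᵥ y / (y ⬝ᵥ y) with hc
  refine Runs.forLoop (fun d M' => M'.g = M.g ∧ M'.s = M.s ∧ M'.o = M.o ∧ M'.r 0 = c ∧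
    (∀ y, y ≠ 12 → M'.v y = M.v y) ∧
    (∀ w, w < k * D ∨ k * D + d ≤ w → M'.u w = M.u w) ∧
    ∀ e < d, M'.u (k * D + e) = M.u (k * D + e) - c * M.u (l * D + e)) D (by norm_num) hZ ?_ ?_ ?_ ?_
  · refine ⟨hg, hs, ho, by simp, fun y hy => by simp [hy, hv y hy], fun w _ => by rw [hu], ?_⟩
    intro e he
    omega
  · rintro d - M' - ⟨-, -, -, -, h, -⟩
    rw [eval_V (by norm_num), h _ (by norm_num), hM.v3]
  · rintro d hd M' hd' ⟨hg, hs, ho, hr, hv, hu1, hu2⟩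
    have hN : M'.v 2 = n * m := by rw [hv _ (by norm_num), hM.v2]
    refine Runs.setU hN ?_
    rw [eval_rsub, eval_rmul, eval_r hN, eval_u hN, eval_u hN, eval_nadd, eval_nadd, eval_nconst,
      eval_V (by norm_num), eval_V (by norm_num), eval_V (by norm_num), hd', hv _ (by norm_num),
      hv _ (by norm_num), h15, h16, hr]
    refine ⟨rfl, hg, hs, ho, rfl, fun y hy => by simp [hy, hv y hy], ?_, ?_⟩
    · intro w hw
      simp only [Function.update_apply]
      rw [if_neg (by omega), hu1 w (by omega)]
    · intro e he
      simp only [Function.update_apply]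
      by_cases hed : e = d
      · subst hed
        -- Row `l` lies entirely before or entirely behind row `k`, so it is still intact while row
        -- `k` is being overwritten.
        rw [if_pos rfl, hu1 _ (by omega), hu1]
        rcases lt_or_gt_of_ne hkl with h | h
        · right
          have := Nat.mul_le_mul_right D (Nat.succ_le_of_lt h)
          rw [Nat.succ_mul] at this
          omega
        · left
          have := Nat.mul_le_mul_right D (Nat.succ_le_of_lt h)
          rw [Nat.succ_mul] at this
          omega
      · rw [if_neg (by omega), hu2 e (by omega)]
  · rintro M' - ⟨hg, hs, ho, -, hv, hu1, hu2⟩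
    refine hQ M' ⟨hg, hs, ho, fun y hy => hv y (by omega)⟩ hv ?_ ?_
    · intro j hj
      funext e
      refine hu1 _ ?_
      have he := e.2
      rcases lt_or_gt_of_ne hj with h | h
      · left
        have := Nat.mul_le_mul_right D (Nat.succ_le_of_lt h)
        rw [Nat.succ_mul] at this
        omega
      · right
        have := Nat.mul_le_mul_right D (Nat.succ_le_of_lt h)
        rw [Nat.succ_mul] at this
        omega
    · funext e
      exact hu2 e e.2

/-- The rows with index below `k` have been orthogonalized. -/
structure Orthogonalized {D : ℕ} (f : ℕ → Fin D → ℝ) (k : ℕ) (y : ℕ → Fin D → ℝ) : Prop where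
  orth : ∀ l < k, ∀ j < l, y l ⬝ᵥ y j = 0
  span : ∀ l < k, y l - f l ∈ Submodule.span ℝ (f '' Set.Iio l)
  rest : ∀ l, k ≤ l → y l = f l

theorem Orthogonalized.mem_span {D : ℕ} {f y : ℕ → Fin D → ℝ} {k : ℕ}
    (h : Orthogonalized f k y) {l : ℕ} (hl : l < k) :
    y l ∈ Submodule.span ℝ (f '' Set.Iio k) := by
  have h1 : y l = (y l - f l) + f l := by abel
  rw [h1]
  refine add_mem (Submodule.span_mono (Set.image_mono fun j hj => ?_) (h.span l hl))
    (Submodule.subset_span ⟨l, hl, rfl⟩)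
  simp only [Set.mem_Iio] at *
  omega

/-- The passage from the old rows to the new ones is unitriangular, hence invertible by strong
induction, even for linearly dependent rows. -/
theorem Orthogonalized.mem_span' {D : ℕ} {f y : ℕ → Fin D → ℝ} {k : ℕ}
    (h : Orthogonalized f k y) (l : ℕ) (hl : l < k) :
    f l ∈ Submodule.span ℝ (y '' Set.Iic l) := by
  induction l using Nat.strong_induction_on with
  | _ l ih =>
    have h1 : f l = y l - (y l - f l) := by abel
    rw [h1]
    refine sub_mem (Submodule.subset_span ⟨l, Set.mem_Iic.2 le_rfl, rfl⟩) ?_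
    refine Submodule.span_le.2 ?_ (h.span l hl)
    rintro _ ⟨j, hj, rfl⟩
    simp only [Set.mem_Iio] at hj
    refine Submodule.span_mono (Set.image_mono fun i hi => ?_) (ih j hj (by omega))
    simp only [Set.mem_Iic] at *
    omega

theorem dotProduct_eq_zero_of_mem_span {D : ℕ} {s : Set (Fin D → ℝ)} {x z : Fin D → ℝ}
    (hs : ∀ y ∈ s, y ⬝ᵥ z = 0) (hx : x ∈ Submodule.span ℝ s) : x ⬝ᵥ z = 0 := by
  induction hx using Submodule.span_induction with
  | mem x h => exact hs x h
  | zero => simp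
  | add x y _ _ hx hy => simp [add_dotProduct, hx, hy]
  | smul a x _ hx => simp [smul_dotProduct, hx]

/-- The earlier old rows are combinations of earlier new rows, to which the last new row is
orthogonal. So the last row solves the system. -/
theorem Orthogonalized.last_orth {D : ℕ} {f y : ℕ → Fin D → ℝ} {k : ℕ}
    (h : Orthogonalized f (k + 1) y) (l : ℕ) (hl : l < k) : f l ⬝ᵥ y k = 0 := by
  refine dotProduct_eq_zero_of_mem_span ?_ (h.mem_span' l (by omega))
  rintro _ ⟨j, hj, rfl⟩
  rw [dotProduct_comm]
  exact h.orth k (Nat.lt_succ_self k) j (lt_of_le_of_lt hj hl)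

/-- The last row was altered only by combinations of the earlier rows, all of which vanish on a
solution `w`. With `last_orth` this characterizes the projection to the solution space. -/
theorem Orthogonalized.last_proj {D : ℕ} {f y : ℕ → Fin D → ℝ} {k : ℕ}
    (h : Orthogonalized f (k + 1) y) {w : Fin D → ℝ} (hw : ∀ l < k, f l ⬝ᵥ w = 0) :
    y k ⬝ᵥ w = f k ⬝ᵥ w := by
  have := dotProduct_eq_zero_of_mem_span (z := w) ?_ (h.span k (Nat.lt_succ_self k))
  · rwa [sub_dotProduct, sub_eq_zero] at this
  · rintro _ ⟨j, hj, rfl⟩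
    exact hw j hj

/-- Each coefficient is taken from the current, partly reduced row `k`. Subtracting a multiple of
row `l` keeps it orthogonal to the rows before `l`, since these are orthogonal to row `l`. -/
theorem runs_orthogonalize (hZ : n * m + n + n * n + 1 ≤ Z) (hM₀ : Ready n m M₀) {Q : Mem → Prop}
    (hQ : ∀ M', Same M₀ M' → M'.v 15 = (n * m + n + n * n + 1) * (n * m + 1) →
      Orthogonalized (rowOf (n * m + 1) M₀) (n * m + n + n * n + 1) (rowOf (n * m + 1) M') → Q M') :
    Runs Z (n * m) orthogonalize M₀ Q := by
  set D := n * m + 1 with hD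
  set f := rowOf D M₀ with hf
  refine Runs.seq (Runs.setV (by norm_num) ?_)
  rw [eval_nconst]
  refine Runs.forLoop (fun k M' => Same M₀ M' ∧ M'.v 15 = k * D ∧ Orthogonalized f k (rowOf D M'))
    (n * m + n + n * n + 1) (by norm_num) hZ ?_ ?_ ?_ fun M' _ h => hQ M' h.1 h.2.1 h.2.2
  · refine ⟨((Same.refl _).setV (by norm_num)).setV (by norm_num), by simp, ?_, ?_, fun _ _ => rfl⟩
    · intro l hl; omega
    · intro l hl; omega
  · rintro k - M' - ⟨h, -⟩
    rw [eval_V (by norm_num), (h.ready hM₀).v6]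
  rintro k hk M1 hk1 ⟨h1, hp1, ho1⟩
  refine Runs.seq (Runs.setV (by norm_num) ?_)
  rw [eval_nconst]
  refine Runs.seq ?_
  refine Runs.forLoop (fun l M' => Same M₀ M' ∧ M'.v 15 = k * D ∧ M'.v 16 = l * D ∧ M'.v 10 = k ∧
    (∀ j, j ≠ k → rowOf D M' j = rowOf D M1 j) ∧
    (∀ j < l, rowOf D M' k ⬝ᵥ rowOf D M1 j = 0) ∧
    rowOf D M' k - f k ∈ Submodule.span ℝ (f '' Set.Iio k)) k (by norm_num) (by omega) ?_ ?_ ?_ ?_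
  · refine ⟨(h1.setV (by norm_num)).setV (by norm_num), by simp [hp1], by simp, by simp [hk1],
      fun _ _ => rfl, fun j hj => by omega, ?_⟩
    have h2 : rowOf D M1 k = f k := ho1.rest k le_rfl
    show rowOf D M1 k - f k ∈ _
    rw [h2, sub_self]
    exact zero_mem _
  · rintro l - M' - ⟨-, -, -, h, -⟩
    rw [eval_V (by norm_num), h]
  · rintro l hl M2 hl2 ⟨h2, hp2, hq2, hk2, hr2, ho2, hs2⟩
    refine Runs.seq (runs_reduceRow hl.ne' (by omega) (h2.ready hM₀) hp2 hq2 ?_)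
    intro M3 hsame hv3 hrow3 hrowk
    refine Runs.incr (by norm_num) ?_
    have h3 := h2.trans hsame
    rw [eval_V (by norm_num), (h3.ready hM₀).v3]
    refine ⟨by simp [hv3, hl2], (h3.setV (by norm_num)).setV (by norm_num), by simp [hv3, hp2],
      ?_, by simp [hv3, hk2], ?_, ?_, ?_⟩
    · simp [hv3, hq2]
      ring
    · exact fun j hj => (hrow3 j hj).trans (hr2 j hj)
    · intro j hj
      show rowOf D M3 k ⬝ᵥ _ = 0
      rw [hrowk, hr2 l hl.ne, sub_dotProduct, smul_dotProduct, smul_eq_mul]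
      rcases Nat.lt_succ_iff_lt_or_eq.1 hj with hj' | rfl
      · rw [ho2 j hj', ho1.orth l hl j hj', mul_zero, sub_zero]
      -- Dependent rows have been reduced to zero. Division by zero yields zero, and everything is
      -- orthogonal to a zero row, so the program needs no rank test.
      · by_cases hz : rowOf D M1 j ⬝ᵥ rowOf D M1 j = 0
        · rw [dotProduct_self_eq_zero] at hz
          simp [hz]
        · field_simp
          simp
    · show rowOf D M3 k - f k ∈ _
      rw [hrowk, sub_right_comm]
      refine sub_mem hs2 (Submodule.smul_mem _ _ ?_)
      rw [hr2 l hl.ne]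
      exact ho1.mem_span hl
  · rintro M2 - ⟨h2, hp2, hq2, hk2, hr2, ho2, hs2⟩
    refine Runs.incr (by norm_num) ?_
    rw [eval_V (by norm_num), (h2.ready hM₀).v3]
    refine ⟨by simp [hk2], (h2.setV (by norm_num)).setV (by norm_num), ?_, ?_, ?_, ?_⟩
    · simp [hp2]
      ring
    · intro l hl j hj
      show rowOf D M2 l ⬝ᵥ rowOf D M2 j = 0
      rw [hr2 j (by omega)]
      rcases Nat.lt_succ_iff_lt_or_eq.1 hl with hl' | rfl
      · rw [hr2 l hl'.ne, ho1.orth l hl' j hj]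
      · exact ho2 j hj
    · intro l hl
      show rowOf D M2 l - f l ∈ _
      rcases Nat.lt_succ_iff_lt_or_eq.1 hl with hl' | rfl
      · rw [hr2 l hl'.ne]
        exact ho1.span l hl'
      · exact hs2
    · intro l hl
      show rowOf D M2 l = f l
      rw [hr2 l (by omega), ho1.rest l (by omega)]

end

end RealRAM

namespace RealRAM

section
variable {n m Z : ℕ} {M₀ : Mem}

/-! ### The output list -/

/-- The points in the output list. -/
def outPoints (n : ℕ) (M : Mem) : Set (Fin n → ℝ) :=
  {p | ∃ e < M.v 8, p = fun i : Fin n => M.o (e * n + i)}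

/-- The block `a` of the solution `z` has nonnegative weights. -/
def GoodBlock (n m : ℕ) (z : ℕ → ℝ) (a : ℕ) : Prop :=
  0 < z (n * m) ∧ ∀ j < m, 0 ≤ z (a * m + j)

/-- The point given by the weights in the block `a` of the solution `z`. -/
noncomputable def blockPoint (n m : ℕ) (s z : ℕ → ℝ) (a : ℕ) (i : ℕ) : ℝ :=
  (∑ j ∈ Finset.range m, z (a * m + j) * s (i + j * n)) / z (n * m)

/-- The memories agree except for the output and local variables. -/
structure SameInput (M M' : Mem) : Prop where
  g : M'.g = M.g
  s : M'.s = M.s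
  u : M'.u = M.u
  v : ∀ y < 10, y ≠ 7 → y ≠ 8 → M'.v y = M.v y

theorem SameInput.ready {M M' : Mem} (h : SameInput M M') (hM : Ready n m M) : Ready n m M' :=
  hM.congr fun y hy => h.v y (by omega) (by omega) (by omega)

theorem SameInput.setV {M M' : Mem} (h : SameInput M M') {x k : ℕ} (hx : 7 ≤ x) (hx' : x ≠ 9) :
    SameInput M { M' with v := Function.update M'.v x k } :=
  ⟨h.g, h.s, h.u, fun y hy h7 h8 => by simp [show y ≠ x by omega, h.v y hy h7 h8]⟩

theorem SameInput.setR {M M' : Mem} (h : SameInput M M') {r' : ℕ → ℝ} :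
    SameInput M { M' with r := r' } := ⟨h.g, h.s, h.u, h.v⟩

theorem runs_emitPoint (hZ : n + m ≤ Z) {M : Mem} {Q : Mem → Prop} (hM : Ready n m M) {p a : ℕ}
    (h15 : M.v 15 = p + a * m) (h16 : M.v 16 = p + n * m) (h7 : M.v 7 = M.v 8 * n)
    (hQ : ∀ M', SameInput M M' → M'.v 15 = M.v 15 → M'.v 16 = M.v 16 → M'.v 10 = M.v 10 →
      M'.v 8 = M.v 8 + 1 → M'.v 7 = M'.v 8 * n → (∀ w < M.v 7, M'.o w = M.o w) →
      (∀ i < n, M'.o (M.v 8 * n + i) = blockPoint n m M.s (fun d => M.u (p + d)) a i) → Q M') :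
    Runs Z (n * m) emitPoint M Q := by
  refine Runs.seq (Runs.forLoop (fun i M' => SameInput M M' ∧ M'.v 15 = M.v 15 ∧
    M'.v 16 = M.v 16 ∧ M'.v 10 = M.v 10 ∧ M'.v 8 = M.v 8 ∧ M'.v 7 = M.v 7 + i ∧
    (∀ w < M.v 7, M'.o w = M.o w) ∧ ∀ i' < i, M'.o (M.v 8 * n + i') =
      blockPoint n m M.s (fun d => M.u (p + d)) a i') n (by norm_num) (by omega) ?_ ?_ ?_ ?_)
  · exact ⟨SameInput.setV ⟨rfl, rfl, rfl, fun _ _ _ _ => rfl⟩ (by norm_num) (by norm_num),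
      by simp, by simp, by simp, by simp, by simp, fun w _ => rfl, fun i' hi' => by omega⟩
  · rintro k - M' - ⟨h, -⟩
    rw [eval_V (by norm_num), (h.ready hM).v0]
  · rintro i hi M1 hi1 ⟨h1, hp1, hq1, ha1, hc1, hd1, ho1, hn1⟩
    have hN := (h1.ready hM).v2
    refine Runs.seq (Runs.setR hN (Runs.seq (Runs.setV (by norm_num) (Runs.seq ?_))))
    refine Runs.forLoop (fun j M' => SameInput M M' ∧ M'.v 15 = M.v 15 ∧ M'.v 16 = M.v 16 ∧
      M'.v 10 = M.v 10 ∧ M'.v 8 = M.v 8 ∧ M'.v 7 = M.v 7 + i ∧ M'.o = M1.o ∧ M'.v 11 = i ∧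
      M'.v 13 = i + j * n ∧ M'.r 0 = ∑ j' ∈ Finset.range j, M.u (p + (a * m + j')) *
        M.s (i + j' * n)) m (by norm_num) (by omega) ?_ ?_ ?_ ?_
    · refine ⟨(h1.setR.setV (by norm_num) (by norm_num)).setV (by norm_num) (by norm_num),
        by simp [hp1], by simp [hq1], by simp [ha1], by simp [hc1], by simp [hd1], rfl,
        by simp [hi1], ?_, by simp [eval_nconst, eval_rconst]⟩
      rw [eval_V (by norm_num)]
      simp [hi1]
    · rintro k - M' - ⟨h, -⟩
      rw [eval_V (by norm_num), (h.ready hM).v1]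
    · rintro j hj M2 hj2 ⟨h2, hp2, hq2, ha2, hc2, hd2, ho2, hi2, hs2, hr2⟩
      have hN := (h2.ready hM).v2
      have hq : i + j * n < n * m := by
        have := mul_add_lt_mul hj hi
        rw [mul_comm m] at this
        omega
      refine Runs.seq (Runs.setR hN (Runs.incr (by norm_num) ?_))
      rw [eval_V (by norm_num), eval_radd, eval_rmul, eval_r hN, eval_u hN, eval_nadd, eval_s,
        eval_V (by norm_num), eval_V (by norm_num), eval_V (by norm_num), hs2, hj2, hp2, h15,
        eval_nconst, hr2, h2.u, h2.s]
      · refine ⟨by simp [hj2], ⟨h2.g, rfl, rfl, fun y hy h7 h8 => by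
          simp [show y ≠ 14 by omega, show y ≠ 13 by omega, h2.v y hy h7 h8]⟩, by simp [hp2, h15], by simp [hq2], by simp [ha2], by simp [hc2],
          by simp [hd2], ho2, by simp [hi2], ?_, ?_⟩
        · simp [(h2.ready hM).v0]
          ring
        · simp [Finset.sum_range_succ, add_assoc]
      · rwa [eval_V (by norm_num), hs2]
    · rintro M2 - ⟨h2, hp2, hq2, ha2, hc2, hd2, ho2, hi2, hs2, hr2⟩
      have hN := (h2.ready hM).v2
      refine Runs.seq (Runs.setO hN (Runs.incr (by norm_num) ?_))
      rw [eval_V (by norm_num), eval_rdiv, eval_r hN, eval_u hN, eval_V (by norm_num), eval_nconst,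
        eval_nconst, hd2, hr2, hq2, h16, h2.u, ho2]
      refine ⟨by simp [hi2], ⟨h2.g, h2.s, rfl, fun y hy h7 h8 => by
        simp [show y ≠ 11 by omega, h7, h2.v y hy h7 h8]⟩, by simp [hp2], by simp [hq2, h16], by simp [ha2], by simp [hc2], ?_, ?_, ?_⟩
      · simp [add_assoc]
      · intro w hw
        simp only [Function.update_apply]
        rw [if_neg (by omega), ho1 w hw]
      · intro i' hi'
        simp only [Function.update_apply]
        rcases Nat.lt_succ_iff_lt_or_eq.1 hi' with h | rfl
        · rw [if_neg (by omega), hn1 i' h]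
        · rw [if_pos (by omega)]
          rfl
  · rintro M' - ⟨h1, hp1, hq1, ha1, hc1, hd1, ho1, hn1⟩
    refine Runs.incr (by norm_num) (hQ _ (h1.setV (by norm_num) (by norm_num)) (by simp [hp1])
      (by simp [hq1]) (by simp [ha1]) ?_ ?_ ho1 hn1)
    · simp [hc1, eval_nconst]
    · simp [hc1, hd1, h7, eval_nconst]
      ring

/-- Pointer 15 arrives one row past the end, and `q` is the start of the last row. Each block is
tested by itself: the signs of the other blocks do not matter for its point to lie in the convex
hull. Variable 7 counts the reals written, variable 8 the points. -/
theorem runs_emitPoints (hZ : n + m ≤ Z) (hM₀ : Ready n m M₀) {q : ℕ} {Q : Mem → Prop}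
    (h15 : M₀.v 15 = q + (n * m + 1)) (h7 : M₀.v 7 = M₀.v 8 * n)
    (hQ : ∀ M', SameInput M₀ M' → M'.v 7 = M'.v 8 * n → M'.v 8 ≤ M₀.v 8 + n →
      outPoints n M' = outPoints n M₀ ∪ {x | ∃ a < n, GoodBlock n m (fun d => M₀.u (q + d)) a ∧
        x = fun i : Fin n => blockPoint n m M₀.s (fun d => M₀.u (q + d)) a i} → Q M') :
    Runs Z (n * m) emitPoints M₀ Q := by
  set z : ℕ → ℝ := fun d => M₀.u (q + d) with hz
  refine Runs.seq (Runs.setV (by norm_num) (Runs.seq (Runs.setV (by norm_num) ?_)))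
  rw [eval_nsub, eval_nadd, eval_V (by norm_num), eval_V (by norm_num), eval_V (by norm_num),
    eval_V (by norm_num), h15, hM₀.v3]
  simp only [Nat.add_sub_cancel, Function.update_self]
  refine Runs.forLoop (fun a M' => SameInput M₀ M' ∧ M'.v 15 = q + a * m ∧ M'.v 16 = q + n * m ∧
    M'.v 7 = M'.v 8 * n ∧ M'.v 8 ≤ M₀.v 8 + a ∧
    outPoints n M' = outPoints n M₀ ∪ {x | ∃ b < a, GoodBlock n m z b ∧
      x = fun i : Fin n => blockPoint n m M₀.s z b i}) n (by norm_num) (by omega) ?_ ?_ ?_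
      fun M' _ h => hQ M' h.1 h.2.2.2.1 h.2.2.2.2.1 h.2.2.2.2.2
  · refine ⟨((SameInput.setV ⟨rfl, rfl, rfl, fun _ _ _ _ => rfl⟩ (by norm_num) (by norm_num)).setV
      (by norm_num) (by norm_num)).setV (by norm_num) (by norm_num), by simp, ?_, by simp [h7],
      by simp, ?_⟩
    · simp [hM₀.v2]
    · simp [outPoints]
  · rintro k - M' - ⟨h, -⟩
    rw [eval_V (by norm_num), (h.ready hM₀).v0]
  rintro a ha M1 ha1 ⟨h1, hp1, hq1, hd1, hc1, hout1⟩
  refine Runs.seq (Runs.setV (by norm_num) (Runs.seq ?_))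
  rw [eval_nconst]
  -- the sign of the scaling factor
  refine Runs.mono (Q' := fun M' => ∃ f, M' = { M1 with v := Function.update M1.v 12 f } ∧
    f = if 0 < z (n * m) then 1 else 0) ?_ ?_
  · refine Runs.ite (fun hb => Runs.setV (by norm_num) ?_) (fun hb => Runs.skip ?_)
    all_goals
      simp only [Test.Holds] at hb
      rw [eval_rconst, eval_u (by simp [(h1.ready hM₀).v2]), eval_V (by norm_num)] at hb
      simp only [Function.update_apply] at hb
      rw [if_neg (by norm_num), hq1, h1.u] at hb
      rw [Rat.cast_zero] at hb
    · rw [if_pos hb]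
      exact ⟨_, by simp [eval_nconst], rfl⟩
    · rw [if_neg hb]
      exact ⟨_, rfl, rfl⟩
  rintro _ ⟨f, rfl, hf⟩
  refine Runs.seq ?_
  -- the signs of the weights
  refine Runs.forLoop (fun k M' => SameInput M₀ M' ∧ M'.v 15 = q + a * m ∧ M'.v 16 = q + n * m ∧
    M'.v 10 = a ∧ M'.o = M1.o ∧ M'.v 7 = M1.v 7 ∧ M'.v 8 = M1.v 8 ∧
    M'.v 12 = if 0 < z (n * m) ∧ ∀ j < k, 0 ≤ z (a * m + j) then 1 else 0) m (by norm_num)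
    (by omega) ?_ ?_ ?_ ?_
  · refine ⟨(h1.setV (by norm_num) (by norm_num)).setV (by norm_num) (by norm_num), by simp [hp1],
      by simp [hq1], by simp [ha1], rfl, by simp, by simp, by simp [hf]⟩
  · rintro k - M' - ⟨h, -⟩
    rw [eval_V (by norm_num), (h.ready hM₀).v1]
  · rintro k hk M2 hk2 ⟨h2, hp2, hq2, ha2, ho2, hd2, hc2, hf2⟩
    have hN := (h2.ready hM₀).v2
    refine Runs.ite (fun hb => Runs.setV (by norm_num) ?_) (fun hb => Runs.skip ?_)
    all_goals
      simp only [Test.Holds] at hb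
      rw [eval_rconst, eval_u hN, eval_nadd, eval_V (by norm_num), eval_V (by norm_num), hk2, hp2,
        h2.u, Rat.cast_zero, add_assoc] at hb
    · refine ⟨by simp [hk2], (h2.setV (by norm_num) (by norm_num)).setV (by norm_num)
        (by norm_num), by simp [hp2], by simp [hq2], by simp [ha2], ho2, by simp [hd2],
        by simp [hc2], ?_⟩
      rw [if_neg]
      · simp [eval_nconst]
      · rintro ⟨-, h⟩
        exact absurd (h k (Nat.lt_succ_self k)) (not_le.2 hb)
    · refine ⟨hk2, h2.setV (by norm_num) (by norm_num), by simp [hp2], by simp [hq2],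
        by simp [ha2], ho2, by simp [hd2], by simp [hc2], ?_⟩
      simp only [Function.update_apply]
      rw [if_neg (by norm_num), hf2]
      congr 2
      rw [Nat.forall_lt_succ_right]
      simp only [not_lt] at hb
      simp [show 0 ≤ z (a * m + k) from hb]
  rintro M2 - ⟨h2, hp2, hq2, ha2, ho2, hd2, hc2, hf2⟩
  have hout2 : outPoints n M2 = outPoints n M1 := by
    simp only [outPoints, hc2, ho2]
  have hsplit : {x : Fin n → ℝ | ∃ b < a + 1, GoodBlock n m z b ∧
      x = fun i : Fin n => blockPoint n m M₀.s z b i} = {x | ∃ b < a, GoodBlock n m z b ∧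
      x = fun i : Fin n => blockPoint n m M₀.s z b i} ∪ {x | GoodBlock n m z a ∧
      x = fun i : Fin n => blockPoint n m M₀.s z a i} := by
    ext x
    simp only [Set.mem_union, Set.mem_ofPred_eq]
    constructor
    · rintro ⟨b, hb, h⟩
      rcases Nat.lt_succ_iff_lt_or_eq.1 hb with h' | rfl
      · exact .inl ⟨b, h', h⟩
      · exact .inr h
    · rintro (⟨b, hb, h⟩ | h)
      · exact ⟨b, by omega, h⟩
      · exact ⟨a, by omega, h⟩
  refine Runs.seq ?_
  refine Runs.mono (Q' := fun M' => SameInput M₀ M' ∧ M'.v 15 = q + a * m ∧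
    M'.v 16 = q + n * m ∧ M'.v 10 = a ∧ M'.v 7 = M'.v 8 * n ∧ M'.v 8 ≤ M₀.v 8 + (a + 1) ∧
    outPoints n M' = outPoints n M₀ ∪ {x | ∃ b < a + 1, GoodBlock n m z b ∧
      x = fun i : Fin n => blockPoint n m M₀.s z b i}) ?_ ?_
  · refine Runs.ite (fun hb => ?_) (fun hb => Runs.skip ?_)
    · simp only [Test.Holds] at hb
      rw [eval_V (by norm_num), hf2, eval_nconst] at hb
      have hgood : GoodBlock n m z a := by
        by_contra h
        rw [if_neg (by exact h)] at hb
        exact absurd hb (by norm_num)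
      refine runs_emitPoint (p := q) (a := a) hZ (h2.ready hM₀) hp2 hq2
        (by rw [hd2, hc2, hd1]) ?_
      intro M3 h3 hp3 hq3 ha3 hc3 hd3 ho3 hn3
      refine ⟨⟨h3.g.trans h2.g, h3.s.trans h2.s, h3.u.trans h2.u, fun y hy h7 h8 =>
        (h3.v y hy h7 h8).trans (h2.v y hy h7 h8)⟩, by rw [hp3, hp2], by rw [hq3, hq2],
        by rw [ha3, ha2], hd3, by rw [hc3, hc2]; omega, ?_⟩
      rw [hsplit, ← Set.union_assoc, ← hout1, ← hout2]
      rw [h2.s, h2.u] at hn3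
      ext x
      simp only [outPoints, Set.mem_union, Set.mem_ofPred_eq, hc3]
      have hold : ∀ e < M2.v 8, (fun i : Fin n => M3.o (e * n + i)) =
          fun i : Fin n => M2.o (e * n + i) := by
        intro e he
        funext i
        refine ho3 _ ?_
        rw [hd2, hd1, ← hc2]
        exact mul_add_lt_mul he i.2
      have hnew : (fun i : Fin n => M3.o (M2.v 8 * n + i)) =
          fun i : Fin n => blockPoint n m M₀.s z a i := funext fun i => hn3 i i.2
      constructor
      · rintro ⟨e, he, rfl⟩
        rcases Nat.lt_succ_iff_lt_or_eq.1 he with h | rfl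
        · exact .inl ⟨e, h, hold e h⟩
        · exact .inr ⟨hgood, hnew⟩
      · rintro (⟨e, he, rfl⟩ | ⟨-, rfl⟩)
        · exact ⟨e, by omega, (hold e he).symm⟩
        · exact ⟨M2.v 8, by omega, hnew.symm⟩
    · simp only [Test.Holds] at hb
      rw [eval_V (by norm_num), hf2, eval_nconst] at hb
      have hgood : ¬ GoodBlock n m z a := fun h => hb (if_pos h)
      refine ⟨h2, hp2, hq2, ha2, by rw [hd2, hc2, hd1], by rw [hc2]; omega, ?_⟩
      rw [hsplit, ← Set.union_assoc, ← hout1, ← hout2]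
      simp [hgood]
  · rintro M3 ⟨h3, hp3, hq3, ha3, hd3, hc3, hout3⟩
    refine Runs.incr (by norm_num) ?_
    rw [eval_V (by norm_num), (h3.ready hM₀).v1]
    refine ⟨by simp [ha3], (h3.setV (by norm_num) (by norm_num)).setV (by norm_num) (by norm_num),
      ?_, by simp [hq3], by simp [hd3], by simpa using hc3, ?_⟩
    · simp [hp3]
      ring
    · rw [← hout3]
      simp [outPoints]

/-! ### Counting -/

/-- When one is added, the carry reaches position `k` exactly if `B ^ k` divides `v + 1`. -/
theorem succ_div_pow_mod (B v k : ℕ) (hB : 0 < B) : (v + 1) / B ^ k % B =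
    if B ^ k ∣ v + 1 then (if v / B ^ k % B + 1 < B then v / B ^ k % B + 1 else 0)
    else v / B ^ k % B := by
  rw [Nat.succ_div]
  split_ifs with h1 h2
  · rw [Nat.add_mod, Nat.mod_eq_of_lt (a := _ % B + 1 % B)]
    · rcases Nat.lt_or_ge 1 B with h | h
      · rw [Nat.mod_eq_of_lt h]
      · omega
    · exact lt_of_le_of_lt (Nat.add_le_add_left (Nat.mod_le 1 B) _) h2
  · have h3 := Nat.mod_lt (v / B ^ k) hB
    have h4 : v / B ^ k % B + 1 = B := by omega
    have h5 : (v / B ^ k + 1) % B = (v / B ^ k % B + 1) % B := by simp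
    rw [h5, h4, Nat.mod_self]
  · simp

/-- The carry is passed on exactly if it has arrived and meets the digit `B - 1`. -/
theorem pow_succ_dvd_succ_iff (B v k : ℕ) (hB : 0 < B) :
    B ^ (k + 1) ∣ v + 1 ↔ B ^ k ∣ v + 1 ∧ ¬ v / B ^ k % B + 1 < B := by
  have h3 := Nat.mod_lt (v / B ^ k) hB
  have h5 : (v / B ^ k + 1) % B = (v / B ^ k % B + 1) % B := by simp
  constructor
  · intro h
    have hk : B ^ k ∣ v + 1 := (pow_dvd_pow B (Nat.le_succ k)).trans h
    refine ⟨hk, fun hlt => ?_⟩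
    obtain ⟨c, hc⟩ := h
    have h6 : (v + 1) / B ^ k = B * c := by
      rw [hc, pow_succ, mul_assoc, Nat.mul_div_cancel_left _ (pow_pos hB k)]
    rw [Nat.succ_div, if_pos hk] at h6
    have h7 : (v / B ^ k + 1) % B = 0 := by rw [h6, Nat.mul_mod_right]
    rw [h5, Nat.mod_eq_of_lt hlt] at h7
    omega
  · rintro ⟨⟨c, hc⟩, hlt⟩
    have h6 : (v + 1) / B ^ k = c := by rw [hc, Nat.mul_div_cancel_left _ (pow_pos hB k)]
    rw [Nat.succ_div, if_pos ⟨c, hc⟩] at h6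
    have h4 : v / B ^ k % B + 1 = B := by omega
    rw [h4, Nat.mod_self, h6] at h5
    obtain ⟨d, hd⟩ := Nat.dvd_of_mod_eq_zero h5
    exact ⟨d, by rw [hc, hd, pow_succ, mul_assoc]⟩

/-- Variable 9 holds the carry. What leaves the last position signals `c + 1 = B ^ K`, because `c +
1` is at most `B ^ K`; this ends the main loop. -/
theorem runs_nextDigits (hnm : 0 < n * m) (hZ : 2 * (n * n) ≤ Z) (hM₀ : Ready n m M₀) {c : ℕ}
    (hc : c < (n * m) ^ (n * n - 1 + n * n))
    (hg : ∀ k < n * n - 1 + n * n, M₀.g k = c / (n * m) ^ k % (n * m)) {Q : Mem → Prop}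
    (hQ : ∀ M', M'.s = M₀.s → M'.o = M₀.o → (∀ y < 9, M'.v y = M₀.v y) →
      (M'.v 9 = 0 ↔ c + 1 < (n * m) ^ (n * n - 1 + n * n)) →
      (∀ k < n * n - 1 + n * n, M'.g k = (c + 1) / (n * m) ^ k % (n * m)) → Q M') :
    Runs Z (n * m) nextDigits M₀ Q := by
  set B := n * m with hB
  set K := n * n - 1 + n * n with hK
  refine Runs.seq (Runs.setV (by norm_num) ?_)
  refine Runs.forLoop (fun k M' => M'.s = M₀.s ∧ M'.o = M₀.o ∧ (∀ y < 9, M'.v y = M₀.v y) ∧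
    (M'.v 9 = if B ^ k ∣ c + 1 then 1 else 0) ∧ (∀ j < k, M'.g j = (c + 1) / B ^ j % B) ∧
    ∀ j, k ≤ j → M'.g j = M₀.g j) K (by norm_num) (by omega) ?_ ?_ ?_ ?_
  · refine ⟨rfl, rfl, fun y hy => ?_, by simp [eval_nconst], fun j hj => by omega, fun _ _ => rfl⟩
    simp [show y ≠ 9 by omega, show y ≠ 10 by omega]
  · rintro k - M' - ⟨-, -, h, -⟩
    rw [eval_V (by norm_num), h 5 (by norm_num), hM₀.v5]
  · rintro k hk M' hk' ⟨hs, ho, hv, hf, hg1, hg2⟩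
    have hnext := succ_div_pow_mod B c k hnm
    have hdvd := pow_succ_dvd_succ_iff B c k hnm
    rw [← hg k hk] at hnext hdvd
    refine Runs.ite (fun hb => ?_) (fun hb => Runs.skip ?_)
    all_goals
      simp only [Test.Holds] at hb
      rw [eval_V (by norm_num), hf, eval_nconst] at hb
    · have hdk : B ^ k ∣ c + 1 := by
        by_contra h
        rw [if_neg h] at hb
        exact absurd hb (by norm_num)
      rw [if_pos hdk] at hnext
      simp only [hdk, true_and] at hdvd
      refine Runs.ite (fun hb' => Runs.seq (Runs.setG (Runs.setV (by norm_num) ?_)))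
        (fun hb' => Runs.setG ?_)
      all_goals
        simp only [Test.Holds] at hb'
        rw [eval_nadd, eval_nconst, eval_G, eval_V (by norm_num), eval_V (by norm_num), hk',
          hg2 k le_rfl, hv 2 (by norm_num), hM₀.v2] at hb'
      · rw [if_pos hb'] at hnext
        rw [eval_nadd, eval_G, eval_V (by norm_num), hk', hg2 k le_rfl]
        simp only [eval_nconst]
        refine ⟨by simp [hk'], hs, ho, fun y hy => ?_, ?_, ?_, ?_⟩
        · simp [show y ≠ 9 by omega, show y ≠ 10 by omega, hv y hy]
        · rw [if_neg (fun h => (hdvd.1 h) hb')]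
          simp
        · intro j hj
          simp only [Function.update_apply]
          rcases Nat.lt_succ_iff_lt_or_eq.1 hj with h | rfl
          · rw [if_neg h.ne, hg1 j h]
          · rw [if_pos rfl, hnext]
        · intro j hj
          simp only [Function.update_apply]
          rw [if_neg (by omega), hg2 j (by omega)]
      · rw [if_neg hb'] at hnext
        rw [eval_V (by norm_num), hk', eval_nconst]
        refine ⟨rfl, hs, ho, fun y hy => ?_, ?_, ?_, ?_⟩
        · simp [show y ≠ 10 by omega, hv y hy]
        · rw [if_pos (hdvd.2 hb')]
          simp [hf, hdk]
        · intro j hj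
          simp only [Function.update_apply]
          rcases Nat.lt_succ_iff_lt_or_eq.1 hj with h | rfl
          · rw [if_neg h.ne, hg1 j h]
          · rw [if_pos rfl, hnext]
        · intro j hj
          simp only [Function.update_apply]
          rw [if_neg (by omega), hg2 j (by omega)]
    · have hdk : ¬ B ^ k ∣ c + 1 := fun h => hb (by rw [if_pos h])
      rw [if_neg hdk] at hnext
      refine ⟨hk', hs, ho, fun y hy => ?_, ?_, ?_, fun j hj => hg2 j (by omega)⟩
      · simp [show y ≠ 10 by omega, hv y hy]
      · rw [if_neg (fun h => hdk (hdvd.1 h).1)]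
        simp [hf, hdk]
      · intro j hj
        rcases Nat.lt_succ_iff_lt_or_eq.1 hj with h | rfl
        · exact hg1 j h
        · rw [hnext]
          exact hg2 j le_rfl
  · rintro M' - ⟨hs, ho, hv, hf, hg1, -⟩
    refine hQ M' hs ho hv ?_ hg1
    rw [hf]
    constructor
    · intro h
      refine lt_of_le_of_ne hc fun he => ?_
      rw [if_pos (by rw [← he])] at h
      exact absurd h (by norm_num)
    · intro h
      rw [if_neg fun hd => absurd (Nat.le_of_dvd (Nat.succ_pos c) hd) (not_le.2 h)]

end

end RealRAM

/-! ### The linear systems -/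

section
variable {n m : ℕ}

/-- `(y, t)` solves the homogeneous linear system given by the support `A` and the set `T` of tight
constraints. -/
structure SysNull (s : Fin m → Fin n → ℝ) (A : Finset (Fin n × Fin m)) (T : Finset (Fin n × Fin n))
    (y : Fin n → Fin m → ℝ) (t : ℝ) : Prop where
  supp : ∀ a j, (a, j) ∉ A → y a j = 0
  sum : ∀ a, ∑ j, y a j = t
  tight : ∀ i b, (i, b) ∈ T → ∑ j, y b j * s j i = ∑ j, y i j * s j i

/-- `(y, t)` is the orthogonal projection of the last unit vector to the space of solutions. -/
structure IsSysProj (s : Fin m → Fin n → ℝ) (A : Finset (Fin n × Fin m))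
    (T : Finset (Fin n × Fin n)) (y : Fin n → Fin m → ℝ) (t : ℝ) : Prop where
  null : SysNull s A T y t
  proj : ∀ y' t', SysNull s A T y' t' → ∑ a, ∑ j, y a j * y' a j + t * t' = t'

/-- The points given by the blocks of nonnegative weights in the projection. -/
def sysPoints (s : Fin m → Fin n → ℝ) (A : Finset (Fin n × Fin m)) (T : Finset (Fin n × Fin n)) :
    Set (Fin n → ℝ) :=
  {p | ∃ y t a, IsSysProj s A T y t ∧ 0 < t ∧ (∀ j, 0 ≤ y a j) ∧
    p = fun i => (∑ j, y a j * s j i) / t}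

/-- Testing each projection against both gives all four inner products, and the squared distance
becomes `t - t' - t + t' = 0`. -/
theorem IsSysProj.unique {s : Fin m → Fin n → ℝ} {A : Finset (Fin n × Fin m)}
    {T : Finset (Fin n × Fin n)} {y y' : Fin n → Fin m → ℝ} {t t' : ℝ} (h : IsSysProj s A T y t)
    (h' : IsSysProj s A T y' t') : y = y' ∧ t = t' := by
  have h1 := h.proj _ _ h.null
  have h2 := h.proj _ _ h'.null
  have h3 := h'.proj _ _ h.null
  have h4 := h'.proj _ _ h'.null
  have key : ∑ a, ∑ j, (y a j - y' a j) ^ 2 + (t - t') ^ 2 = 0 := by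
    have : ∀ a j, (y a j - y' a j) ^ 2 = y a j * y a j - y a j * y' a j - y' a j * y a j +
        y' a j * y' a j := fun a j => by ring
    simp only [this, Finset.sum_add_distrib, Finset.sum_sub_distrib]
    linarith
  have hnn : ∀ a ∈ Finset.univ, 0 ≤ ∑ j, (y a j - y' a j) ^ 2 :=
    fun a _ => Finset.sum_nonneg fun j _ => sq_nonneg _
  have h5 : ∑ a, ∑ j, (y a j - y' a j) ^ 2 = 0 := by
    have := Finset.sum_nonneg hnn
    nlinarith [sq_nonneg (t - t')]
  refine ⟨?_, ?_⟩
  · funext a j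
    have h6 := (Finset.sum_eq_zero_iff_of_nonneg hnn).1 h5 a (Finset.mem_univ a)
    have h7 := (Finset.sum_eq_zero_iff_of_nonneg fun j _ => sq_nonneg _).1 h6 j (Finset.mem_univ j)
    nlinarith
  · rw [h5, zero_add] at key
    nlinarith

theorem sum_range_mul (f : ℕ → ℝ) :
    ∑ d ∈ Finset.range (n * m), f d = ∑ a : Fin n, ∑ j : Fin m, f (a * m + j) := by
  rw [Finset.sum_range, ← Fintype.sum_prod_type', ← finProdFinEquiv.sum_comp]
  refine Finset.sum_congr rfl fun x _ => ?_
  rw [finProdFinEquiv_apply_val]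
  congr 1
  ring

end

/-! ### From digits and matrix rows to linear systems -/

namespace RealRAM

section
variable {n m : ℕ}

/-- The support given by the digits `g`. -/
def digitSupport (n m : ℕ) (g : ℕ → ℕ) : Finset (Fin n × Fin m) :=
  Finset.univ.filter fun x => ∃ l < n * n - 1, g l = x.1 * m + x.2

/-- The set of tight constraints given by the digits `g`. -/
def digitTight (n : ℕ) (g : ℕ → ℕ) : Finset (Fin n × Fin n) :=
  Finset.univ.filter fun x => g (n * n - 1 + (x.1 * n + x.2)) = 0

theorem sysRow_support {si : ℕ → ℝ} {g : ℕ → ℕ} {z : ℕ → ℝ} {k : ℕ} (hk : k < n * m) :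
    ∑ d ∈ Finset.range (n * m + 1), sysRow n m si g k d * z d =
      if ∀ l < n * n - 1, g l ≠ k then z k else 0 := by
  have : ∀ d, sysRow n m si g k d * z d =
      if d = k then (if ∀ l < n * n - 1, g l ≠ k then z k else 0) else 0 := by
    intro d
    rw [sysRow, if_pos hk]
    by_cases h : d = k
    · subst h; split_ifs <;> simp_all
    · simp [h]
  simp only [this, Finset.sum_ite_eq', Finset.mem_range, show k < n * m + 1 by omega, if_true]

theorem sysRow_sum_dot {si : ℕ → ℝ} {g : ℕ → ℕ} {z : ℕ → ℝ} (a : Fin n) :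
    ∑ d ∈ Finset.range (n * m + 1), sysRow n m si g (n * m + a) d * z d =
      ∑ j : Fin m, z (a * m + j) - z (n * m) := by
  rw [Finset.sum_range_succ, sysRow_sum_last a.2, sum_range_mul, Finset.sum_eq_single a]
  · simp only [sysRow_sum a.2 a.2 (Fin.is_lt _), if_true, one_mul]
    ring
  · intro b _ hb
    have : (b : ℕ) ≠ a := fun h => hb (Fin.ext h)
    simp only [sysRow_sum a.2 b.2 (Fin.is_lt _), this, if_false, zero_mul, Finset.sum_const_zero]
  · simp

theorem sysRow_tight_dot {s : Fin m → Fin n → ℝ} {si : ℕ → ℝ}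
    (hs : ∀ (j : Fin m) (i : Fin n), si (i + j * n) = s j i) {g : ℕ → ℕ} {z : ℕ → ℝ}
    (i b : Fin n) :
    ∑ d ∈ Finset.range (n * m + 1), sysRow n m si g (n * m + n + (i * n + b)) d * z d =
      if g (n * n - 1 + (i * n + b)) = 0 then
        ∑ j : Fin m, z (b * m + j) * s j i - ∑ j : Fin m, z (i * m + j) * s j i else 0 := by
  rw [Finset.sum_range_succ, sysRow_tight_last i.2 b.2, sum_range_mul]
  simp only [sysRow_tight i.2 b.2 (Fin.is_lt _) (Fin.is_lt _), hs]
  split_ifs with h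
  · have h1 : ∀ (a c : Fin n) (j : Fin m), (if (a : ℕ) = c then s j i else 0) * z (a * m + j) =
        if a = c then z (c * m + j) * s j i else 0 := by
      intro a c j
      by_cases hac : a = c
      · subst hac; simp [mul_comm]
      · have : (a : ℕ) ≠ c := fun h => hac (Fin.ext h)
        simp [hac, this]
    simp only [sub_mul, h1, Finset.sum_sub_distrib, zero_mul, add_zero]
    congr 1 <;>
    · rw [Finset.sum_comm]
      simp
  · simp

/-- The three families of rows are the three clauses of `SysNull`. The bottom row is excluded: it is
the vector to be projected, not an equation. -/
theorem sysNull_iff {s : Fin m → Fin n → ℝ} {si : ℕ → ℝ}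
    (hs : ∀ (j : Fin m) (i : Fin n), si (i + j * n) = s j i) {g : ℕ → ℕ} {z : ℕ → ℝ} :
    (∀ k < n * m + n + n * n, ∑ d ∈ Finset.range (n * m + 1), sysRow n m si g k d * z d = 0) ↔
      SysNull s (digitSupport n m g) (digitTight n g) (fun a j => z (a * m + j)) (z (n * m)) := by
  constructor
  · intro h
    refine ⟨fun a j haj => ?_, fun a => ?_, fun i b hib => ?_⟩
    · have hlt := mul_add_lt_mul a.2 j.2
      have := h (a * m + j) (by omega)
      rw [sysRow_support hlt, if_pos] at this
      · exact this
      · intro l hl hgl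
        exact haj (by simp only [digitSupport, Finset.mem_filter_univ]; exact ⟨l, hl, hgl⟩)
    · have := h (n * m + a) (by have := a.2; omega)
      rw [sysRow_sum_dot] at this
      linarith
    · have hlt := mul_add_lt_mul i.2 b.2
      have := h (n * m + n + (i * n + b)) (by omega)
      rw [sysRow_tight_dot hs, if_pos] at this
      · linarith
      · simpa [digitTight] using hib
  · rintro ⟨h1, h2, h3⟩ k hk
    by_cases hk1 : k < n * m
    · rw [sysRow_support hk1]
      split_ifs with h
      · have hm : 0 < m := by
          rcases Nat.eq_zero_or_pos m with rfl | hm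
          · simp at hk1
          · exact hm
        have hk2 : k / m < n := Nat.div_lt_of_lt_mul (by rwa [mul_comm])
        have := h1 ⟨k / m, hk2⟩ ⟨k % m, Nat.mod_lt _ hm⟩ ?_
        · simpa [Nat.div_add_mod'] using this
        · simp only [digitSupport, Finset.mem_filter_univ, Nat.div_add_mod']
          rintro ⟨l, hl, hgl⟩
          exact h l hl hgl
      · rfl
    · by_cases hk2 : k < n * m + n
      · obtain ⟨a, rfl⟩ : ∃ a, k = n * m + a := ⟨k - n * m, by omega⟩
        have ha : a < n := by omega
        have := sysRow_sum_dot (m := m) (si := si) (g := g) (z := z) ⟨a, ha⟩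
        rw [this, sub_eq_zero]
        exact h2 ⟨a, ha⟩
      · obtain ⟨q, rfl⟩ : ∃ q, k = n * m + n + q := ⟨k - (n * m + n), by omega⟩
        have hq : q < n * n := by omega
        have hn : 0 < n := by
          rcases Nat.eq_zero_or_pos n with rfl | hn
          · simp at hq
          · exact hn
        have := sysRow_tight_dot hs (g := g) (z := z) ⟨q / n, Nat.div_lt_of_lt_mul hq⟩
          ⟨q % n, Nat.mod_lt _ hn⟩
        simp only [Nat.div_add_mod'] at this
        rw [this]
        split_ifs with h
        · rw [sub_eq_zero]
          exact h3 ⟨q / n, Nat.div_lt_of_lt_mul hq⟩ ⟨q % n, Nat.mod_lt _ hn⟩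
            (by simpa [digitTight, Nat.div_add_mod'] using h)
        · rfl

/-- The last row of the orthogonalized matrix is the projection of the last unit vector. -/
theorem isSysProj_of_orthogonalized {s : Fin m → Fin n → ℝ} {si : ℕ → ℝ}
    (hs : ∀ (j : Fin m) (i : Fin n), si (i + j * n) = s j i) {g : ℕ → ℕ} {M M' : Mem}
    (hM : ∀ k < n * m + n + n * n + 1, ∀ d < n * m + 1,
      M.u (k * (n * m + 1) + d) = sysRow n m si g k d)
    (h : Orthogonalized (rowOf (n * m + 1) M) (n * m + n + n * n + 1) (rowOf (n * m + 1) M')) :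
    IsSysProj s (digitSupport n m g) (digitTight n g)
      (fun a j => M'.u ((n * m + n + n * n) * (n * m + 1) + (a * m + j)))
      (M'.u ((n * m + n + n * n) * (n * m + 1) + n * m)) := by
  set K := n * m + n + n * n with hK
  set z : ℕ → ℝ := fun d => M'.u (K * (n * m + 1) + d) with hz
  have hrow : ∀ k < K + 1, ∀ w : ℕ → ℝ, rowOf (n * m + 1) M k ⬝ᵥ (fun d => w d) =
      ∑ d ∈ Finset.range (n * m + 1), sysRow n m si g k d * w d := by
    intro k hk w
    rw [Finset.sum_range]
    refine Finset.sum_congr rfl fun d _ => ?_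
    rw [rowOf, hM k hk d d.2]
  refine ⟨(sysNull_iff hs (z := z)).1 fun k hk => ?_, fun y' t' h' => ?_⟩
  · rw [← hrow k (by omega)]
    exact h.last_orth k hk
  · set w : ℕ → ℝ := fun d => if hd : d < n * m then
      y' ⟨d / m, Nat.div_lt_of_lt_mul (by rwa [mul_comm])⟩ ⟨d % m, Nat.mod_lt _ (by
        rcases Nat.eq_zero_or_pos m with rfl | hm
        · simp at hd
        · exact hm)⟩ else t' with hw
    have hw1 : ∀ (a : Fin n) (j : Fin m), w (a * m + j) = y' a j := by
      intro a j
      simp only [hw]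
      rw [dif_pos (mul_add_lt_mul a.2 j.2)]
      congr 1
      · simp only [mul_add_div_eq j.2]
      · simp only [mul_add_mod_eq j.2]
    have hw2 : w (n * m) = t' := by simp [hw]
    have hnull : ∀ k < K, rowOf (n * m + 1) M k ⬝ᵥ (fun d => w d) = 0 := by
      intro k hk
      rw [hrow k (by omega)]
      refine (sysNull_iff hs).2 ?_ k hk
      simp only [hw1, hw2]
      exact h'
    have h1 := h.last_proj hnull
    rw [hrow K (by omega)] at h1
    simp only [hK, sysRow_last] at h1
    rw [← hK] at h1
    have h2 : rowOf (n * m + 1) M' K ⬝ᵥ (fun d => w d) =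
        ∑ d ∈ Finset.range (n * m + 1), z d * w d := by
      rw [Finset.sum_range]
      rfl
    rw [h2, Finset.sum_range_succ, sum_range_mul] at h1
    simp only [hw1, hw2] at h1
    rw [h1]
    simp [hw2]

end

end RealRAM

/-! ### The main loop and the whole program -/

namespace RealRAM

section
variable {n m Z : ℕ} {s : Fin m → Fin n → ℝ}

/-- The digits of `c` in base `n * m`. -/
def digit (n m c k : ℕ) : ℕ := c / (n * m) ^ k % (n * m)

theorem digitSupport_congr {g g' : ℕ → ℕ} (h : ∀ k < n * n - 1 + n * n, g k = g' k) :
    digitSupport n m g = digitSupport n m g' := by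
  refine Finset.filter_congr fun x _ => ?_
  refine exists_congr fun l => and_congr_right fun hl => ?_
  rw [h l (by omega)]

theorem digitTight_congr {g g' : ℕ → ℕ} (h : ∀ k < n * n - 1 + n * n, g k = g' k) :
    digitTight n g = digitTight n g' := by
  refine Finset.filter_congr fun x _ => ?_
  rw [h _ (Nat.add_lt_add_left (mul_add_lt_mul x.1.2 x.2.2) _)]

/-- By uniqueness of the projection, the solution in memory is the one meant in `sysPoints`. -/
theorem blockPoints_eq {si : ℕ → ℝ} (hs : ∀ (j : Fin m) (i : Fin n), si (i + j * n) = s j i)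
    {A : Finset (Fin n × Fin m)} {T : Finset (Fin n × Fin n)} {z : ℕ → ℝ}
    (hz : IsSysProj s A T (fun a j => z (a * m + j)) (z (n * m))) :
    {x | ∃ a < n, GoodBlock n m z a ∧ x = fun i : Fin n => blockPoint n m si z a i} =
      sysPoints s A T := by
  have hp : ∀ a : Fin n, (fun i : Fin n => blockPoint n m si z a i) =
      fun i => (∑ j : Fin m, z (a * m + j) * s j i) / z (n * m) := by
    intro a
    funext i
    rw [blockPoint, Finset.sum_range]
    simp only [hs]
  ext x
  constructor
  · rintro ⟨a, ha, hgood, rfl⟩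
    exact ⟨_, _, ⟨a, ha⟩, hz, hgood.1, fun j => hgood.2 j j.2, hp ⟨a, ha⟩⟩
  · rintro ⟨y, t, a, hyt, ht, hy, rfl⟩
    obtain ⟨rfl, rfl⟩ := hyt.unique hz
    exact ⟨a, a.2, ⟨ht, fun j hj => hy ⟨j, hj⟩⟩, (hp a).symm⟩

/-- The situation before the system number `c` is treated. -/
structure LoopInv (s : Fin m → Fin n → ℝ) (c : ℕ) (M : Mem) : Prop where
  ready : Ready n m M
  input : ∀ (j : Fin m) (i : Fin n), M.s (i + j * n) = s j i
  flag : M.v 9 = 0 ↔ c < (n * m) ^ (n * n - 1 + n * n)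
  digits : ∀ k < n * n - 1 + n * n, M.g k = digit n m c k
  len : M.v 7 = M.v 8 * n
  len_le : M.v 8 ≤ c * n
  points : outPoints n M = {p | ∃ c' < c, p ∈ sysPoints s (digitSupport n m (digit n m c'))
    (digitTight n (digit n m c'))}

theorem runs_loopBody (hnm : 0 < n * m) (hZ : n * m + 2 * (n * n) + n + m + 1 ≤ Z) {c : ℕ} {M : Mem}
    (hc : c < (n * m) ^ (n * n - 1 + n * n)) (hM : LoopInv s c M) :
    Runs Z (n * m) (emitMatrix ;; orthogonalize ;; emitPoints ;; nextDigits) M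
      (LoopInv s (c + 1)) := by
  refine Runs.seq (runs_emitMatrix (by omega) hM.ready fun M1 h1 hrows => Runs.seq ?_)
  refine runs_orthogonalize (by omega) (h1.ready hM.ready) fun M2 h2 h15 hort => Runs.seq ?_
  have h12 := h1.trans h2
  have hproj := isSysProj_of_orthogonalized hM.input hrows hort
  refine runs_emitPoints (q := (n * m + n + n * n) * (n * m + 1)) (by omega)
    (h12.ready hM.ready) ?_ ?_ fun M3 h3 h7 h8 hpts => ?_
  · rw [h15]
    ring
  · rw [h12.v 7 (by norm_num), h12.v 8 (by norm_num), hM.len]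
  have hr3 := h3.ready (h12.ready hM.ready)
  refine runs_nextDigits hnm (by omega) hr3 hc ?_ fun M4 hs4 ho4 hv4 hf4 hg4 => ?_
  · intro k hk
    rw [h3.g, h12.g, hM.digits k hk]
    rfl
  refine ⟨hr3.congr fun y hy => hv4 y (by omega), ?_, hf4, hg4, ?_, ?_, ?_⟩
  · rw [hs4, h3.s, h12.s]
    exact hM.input
  · rw [hv4 7 (by norm_num), hv4 8 (by norm_num), h7]
  · rw [hv4 8 (by norm_num), add_mul, one_mul]
    refine h8.trans ?_
    rw [h12.v 8 (by norm_num)]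
    exact Nat.add_le_add_right hM.len_le n
  · have h4 : outPoints n M4 = outPoints n M3 := by
      simp only [outPoints, hv4 8 (by norm_num), ho4]
    have h5 : outPoints n M2 = outPoints n M := by
      simp only [outPoints, h12.v 8 (by norm_num), h12.o]
    have hin : ∀ (j : Fin m) (i : Fin n), M2.s (i + j * n) = s j i := by
      rw [h12.s]; exact hM.input
    rw [h4, hpts, h5, hM.points,
      blockPoints_eq hin (z := fun d => M2.u ((n * m + n + n * n) * (n * m + 1) + d)) hproj,
      digitSupport_congr hM.digits, digitTight_congr hM.digits]
    ext p
    simp only [Set.mem_union, Set.mem_ofPred_eq, Nat.lt_succ_iff_lt_or_eq]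
    constructor
    · rintro (⟨c', hc', h⟩ | h)
      · exact ⟨c', .inl hc', h⟩
      · exact ⟨c, .inr rfl, h⟩
    · rintro ⟨c', hc' | rfl, h⟩
      · exact .inl ⟨c', hc', h⟩
      · exact .inr h

/-- The machine does not multiply naturals, so both products are obtained by repeated addition. -/
theorem runs_initSizes (hZ : n ≤ Z) {M : Mem} {Q : Mem → Prop} (h0 : M.v 0 = n) (h1 : M.v 1 = m)
    (hv : ∀ y, 2 ≤ y → M.v y = 0)
    (hQ : ∀ M', Ready n m M' → M'.g = M.g → M'.s = M.s → M'.o = M.o → M'.v 7 = 0 → M'.v 8 = 0 →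
      M'.v 9 = 0 → Q M') : Runs Z (n * m) initSizes M Q := by
  refine Runs.seq (Runs.forLoop (fun k M' => M'.g = M.g ∧ M'.s = M.s ∧ M'.o = M.o ∧
    (∀ y < 10, y ≠ 2 → M'.v y = M.v y) ∧ M'.v 2 = k * m) n (by norm_num) hZ ?_ ?_ ?_ ?_)
  · refine ⟨rfl, rfl, rfl, fun y hy _ => ?_, by simp [hv 2 le_rfl]⟩
    simp [show y ≠ 10 by omega]
  · rintro k - M' - ⟨-, -, -, h, -⟩
    rw [eval_V (by norm_num), h 0 (by norm_num) (by norm_num), h0]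
  · rintro k hk M' hk' ⟨hg, hs, ho, hv, h2⟩
    refine Runs.incr (by norm_num) ⟨by simp [hk'], hg, hs, ho, fun y hy hy2 => ?_, ?_⟩
    · simp [show y ≠ 10 by omega, hy2, hv y hy hy2]
    · simp only [Function.update_apply]
      rw [if_neg (by norm_num), if_pos trivial, eval_V (by norm_num), h2,
        hv 1 (by norm_num) (by norm_num), h1]
      ring
  rintro M1 - ⟨hg1, hs1, ho1, hv1, h21⟩
  refine Runs.seq (Runs.forLoop (fun k M' => M'.g = M.g ∧ M'.s = M.s ∧ M'.o = M.o ∧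
    (∀ y < 10, y ≠ 4 → M'.v y = M1.v y) ∧ M'.v 4 = k * n) n (by norm_num) hZ ?_ ?_ ?_ ?_)
  · refine ⟨hg1, hs1, ho1, fun y hy _ => ?_, ?_⟩
    · simp [show y ≠ 10 by omega]
    · simp [hv1 4 (by norm_num) (by norm_num), hv 4 (by norm_num)]
  · rintro k - M' - ⟨-, -, -, h, -⟩
    rw [eval_V (by norm_num), h 0 (by norm_num) (by norm_num), hv1 0 (by norm_num) (by norm_num),
      h0]
  · rintro k hk M' hk' ⟨hg, hs, ho, hv, h2⟩
    refine Runs.incr (by norm_num) ⟨by simp [hk'], hg, hs, ho, fun y hy hy2 => ?_, ?_⟩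
    · simp [show y ≠ 10 by omega, hy2, hv y hy hy2]
    · simp only [Function.update_apply]
      rw [if_neg (by norm_num), if_pos trivial, eval_V (by norm_num), h2,
        hv 0 (by norm_num) (by norm_num), hv1 0 (by norm_num) (by norm_num), h0]
      ring
  rintro M2 - ⟨hg2, hs2, ho2, hv2, h42⟩
  have e0 : M2.v 0 = n := by
    rw [hv2 0 (by norm_num) (by norm_num), hv1 0 (by norm_num) (by norm_num), h0]
  have e1 : M2.v 1 = m := by
    rw [hv2 1 (by norm_num) (by norm_num), hv1 1 (by norm_num) (by norm_num), h1]
  have e2 : M2.v 2 = n * m := by rw [hv2 2 (by norm_num) (by norm_num), h21]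
  have e : ∀ y, 7 ≤ y → y < 10 → M2.v y = 0 := by
    intro y hy hy'
    rw [hv2 y hy' (by omega), hv1 y hy' (by omega), hv y (by omega)]
  refine Runs.seq (Runs.setV (by norm_num) (Runs.seq (Runs.setV (by norm_num) (Runs.seq
    (Runs.setV (by norm_num) (Runs.setV (by norm_num) ?_))))))
  simp only [eval_nadd, eval_nsub, eval_nconst, eval_V (show 0 < 64 by norm_num),
    eval_V (show 2 < 64 by norm_num), eval_V (show 4 < 64 by norm_num)]
  refine hQ _ ⟨?_, ?_, ?_, ?_, ?_, ?_, ?_⟩ hg2 hs2 ho2 ?_ ?_ ?_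
  all_goals simp [e0, e1, e2, e, h42]
  ring

/-- Entry `e` moves from cell `n * m + 3 * e` to `n * m + e`. In ascending order no write hits an
entry still to be read. The interleaved layout is destroyed, so the argument is about raw states and
not about `Mem`. -/
theorem exec_moveOutput {M : Mem} (hM : Ready n m M) (hlen : M.v 7 = M.v 8 * n) (hZ : M.v 7 ≤ Z) :
    ∃ t ≤ moveOutput.timeBound Z, ∃ τ, Exec moveOutput (enc (n * m) M) t τ ∧
      output n τ = (Set.range fun j : Fin m => fun i : Fin n => M.s (i + j * n)) ∪
        outPoints n M := by
  have hN := hM.v2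
  have hstart : Exec (.setNat (.const 10) (.const 0)) (enc (n * m) M) _ _ := .setNat _ _ _
  obtain ⟨t, ht, τ, hτ, h1, h2, h3, h4, -⟩ := exec_loop (Z := Z) (b := .natLt (V 10) (V 7))
    (p := .setReal (.add (V 2) (V 10)) (.mem (arr 0 (V 10))) ;;
      .setNat (.const 10) (.add (V 10) (.const 1)))
    (σ := { enc (n * m) M with nat := Function.update (enc (n * m) M).nat 10 0 })
    (fun k σ => (∀ a < 10, σ.nat a = M.v a) ∧ σ.nat 10 = k ∧ (∀ a < n * m, σ.real a = M.s a) ∧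
      (∀ e < k, σ.real (n * m + e) = M.o e) ∧ ∀ e, k ≤ e → σ.real (n * m + 3 * e) = M.o e)
    (M.v 7) hZ
    (by
      refine ⟨fun a ha => ?_, by simp, fun a ha => by simp [enc, ha], fun e he => by omega,
        fun e _ => by simp [enc]⟩
      simp only [Function.update_apply]
      rw [if_neg (by omega)]
      simp [enc, show a < 64 by omega])
    (by
      rintro k hk σ ⟨h1, h2, h3, h4, h5⟩
      refine ⟨?_, _, ?_, _, .seq (.setReal _ _ _) (.setNat _ _ _), ?_⟩
      · simp only [Test.Holds, NatExpr.eval, h2, h1 7 (by norm_num)]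
        exact hk
      · simp only [Program.timeBound]
        exact le_rfl
      · simp only [arr, NatExpr.eval, RealExpr.eval, h2, h1 2 (by norm_num), hN]
        rw [show n * m + (k + (k + k) + 0) = n * m + 3 * k by ring, h5 k le_rfl]
        refine ⟨fun a ha => ?_, by simp, fun a ha => ?_, fun e he => ?_, fun e he => ?_⟩
        · simp only [Function.update_apply]
          rw [if_neg (by omega), h1 a ha]
        · simp only [Function.update_apply]
          rw [if_neg (by omega), h3 a ha]
        · simp only [Function.update_apply]
          rcases Nat.lt_succ_iff_lt_or_eq.1 he with h | rfl
          · rw [if_neg (by omega), h4 e h]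
          · rw [if_pos rfl]
        · simp only [Function.update_apply]
          rw [if_neg (by omega), h5 e (by omega)])
    (by
      rintro σ ⟨h1, h2, -⟩
      simp only [Test.Holds, NatExpr.eval, h2, h1 7 (by norm_num)]
      exact lt_irrefl _)
  refine ⟨_, ?_, _, .seq (.seq hstart hτ) (.setNat _ _ _), ?_⟩
  · simp only [moveOutput, forLoop, Program.timeBound] at ht ⊢
    omega
  · have hlow : ∀ i < m, ∀ j : Fin n, τ.real (i * n + j) = M.s (j + i * n) := by
      intro i hi j
      have := mul_add_lt_mul hi j.2
      rw [mul_comm m] at this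
      rw [h3 _ this, add_comm]
    have hhigh : ∀ e < M.v 8, ∀ j : Fin n, τ.real ((m + e) * n + j) = M.o (e * n + j) := by
      intro e he j
      rw [← h4 (e * n + j) (by rw [hlen]; exact mul_add_lt_mul he j.2)]
      congr 1
      ring
    ext p
    simp only [output, outPoints, NatExpr.eval, Function.update_self, h1 1 (by norm_num),
      h1 8 (by norm_num), hM.v1, Set.mem_union, Set.mem_range, Set.mem_ofPred_eq]
    constructor
    · rintro ⟨i, hi, rfl⟩
      by_cases him : i < m
      · exact .inl ⟨⟨i, him⟩, funext fun j => (hlow i him j).symm⟩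
      · obtain ⟨e, rfl⟩ := Nat.exists_eq_add_of_le (not_lt.1 him)
        exact .inr ⟨e, by omega, funext fun j => hhigh e (by omega) j⟩
    · rintro (⟨i, rfl⟩ | ⟨e, he, rfl⟩)
      · exact ⟨i, by have := i.2; omega, funext fun j => (hlow i i.2 j).symm⟩
      · exact ⟨m + e, by omega, funext fun j => (hhigh e he j).symm⟩

/-- The points found by the algorithm. -/
def foundPoints (s : Fin m → Fin n → ℝ) : Set (Fin n → ℝ) :=
  Set.range s ∪ {p | ∃ c < (n * m) ^ (n * n - 1 + n * n),
    p ∈ sysPoints s (digitSupport n m (digit n m c)) (digitTight n (digit n m c))}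

theorem exec_closureProgram (hn : 1 ≤ n) (hm : 1 ≤ m)
    (hZ : n * m + 2 * (n * n) + n + m + 1 ≤ Z)
    (hZ' : (n * m) ^ (n * n - 1 + n * n) * n * n ≤ Z) (s : Fin m → Fin n → ℝ) :
    ∃ t ≤ closureProgram.timeBound Z, ∃ τ, Exec closureProgram (input s) t τ ∧
      output n τ = foundPoints s := by
  have hnm : 0 < n * m := Nat.mul_pos hn hm
  set M₀ : Mem := ⟨fun a => if a = 0 then n else if a = 1 then m else 0, fun _ => 0,
    (input s).real, fun _ => 0, fun _ => 0, fun _ => 0⟩ with hM₀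
  have hinput : input s = enc (n * m) M₀ := by
    simp only [input, enc, hM₀, State.mk.injEq]
    refine ⟨?_, ?_⟩
    · funext a
      by_cases ha : a < 64
      · simp [ha]
      · simp [ha, show a ≠ 0 by omega, show a ≠ 1 by omega]
    · funext a
      by_cases ha : a < m * n
      · have : a < n * m := by rwa [mul_comm]
        simp [ha, this]
      · have : ¬ a < n * m := by rwa [mul_comm]
        simp [ha, this]
  have hin : ∀ (j : Fin m) (i : Fin n), M₀.s (i + j * n) = s j i := by
    intro j i
    have hlt : (i : ℕ) + j * n < m * n := by
      have := mul_add_lt_mul j.2 i.2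
      omega
    have hij : (⟨i + j * n, hlt⟩ : Fin (m * n)) = finProdFinEquiv (j, i) := by
      ext
      simp [mul_comm]
    simp only [hM₀, input]
    rw [dif_pos hlt, hij, Equiv.symm_apply_apply]
  -- The bound `hZ'` counts systems times blocks times coordinates; it covers the main loop as well
  -- as the final copying.
  have hP1 : ∀ c ≤ (n * m) ^ (n * n - 1 + n * n), c ≤ Z := fun c hc => hc.trans <| by
    refine le_trans ?_ hZ'
    rw [mul_assoc]
    exact Nat.le_mul_of_pos_right _ (Nat.mul_pos hn hn)
  have hrun : Runs Z (n * m) initSizes M₀ fun M => Runs Z (n * m)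
      (.loop (.natEq (V 9) (.const 0)) (emitMatrix ;; orthogonalize ;; emitPoints ;; nextDigits)) M
      (LoopInv s ((n * m) ^ (n * n - 1 + n * n))) := by
    refine runs_initSizes (by omega) (by simp [hM₀]) (by simp [hM₀])
      (fun y hy => by simp [hM₀, show y ≠ 0 by omega, show y ≠ 1 by omega]) ?_
    intro M hR hg hs ho h7 h8 h9
    refine Runs.loop (LoopInv s) _ (hP1 _ le_rfl) ?_ ?_ ?_
    · refine ⟨hR, by rw [hs]; exact hin, ?_, ?_, by simp [h7, h8], by simp [h8], ?_⟩
      · simp [h9, pow_pos hnm]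
      · intro k _
        simp [hg, hM₀, digit]
      · simp [outPoints, h8]
    · intro c hc M' hM'
      refine ⟨?_, runs_loopBody hnm hZ hc hM'⟩
      simp only [Test.Holds]
      rw [eval_V (by norm_num), eval_nconst]
      exact hM'.flag.2 hc
    · intro M' hM'
      refine ⟨?_, hM'⟩
      simp only [Test.Holds]
      rw [eval_V (by norm_num), eval_nconst]
      exact fun h => lt_irrefl _ (hM'.flag.1 h)
  obtain ⟨t, ht, M1, h1, t', ht', M2, h2, hM2⟩ := hrun
  obtain ⟨t'', ht'', τ, h3, hout⟩ := exec_moveOutput (Z := Z) hM2.ready hM2.len (by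
    rw [hM2.len]
    exact (Nat.mul_le_mul_right n hM2.len_le).trans hZ')
  rw [hinput]
  refine ⟨_, ?_, τ, Exec.seq h1 (Exec.seq h2 h3), ?_⟩
  · exact Nat.add_le_add ht (Nat.add_le_add ht' ht'')
  · rw [hout, hM2.points, foundPoints]
    congr 2
    funext j i
    exact hM2.input j i

end

end RealRAM

/-! ### Perturbation of nonnegative vectors and weights for convex hulls -/

open Filter Topology in
/-- Small multiples of a vector whose nonzero coordinates are at positive coordinates of a
nonnegative vector can be added without leaving the nonnegative vectors. -/
theorem eventually_forall_nonneg_add_mul {ι : Type*} [Finite ι] {x d : ι → ℝ}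
    (hx : ∀ i, 0 ≤ x i) (hd : ∀ i, x i = 0 → d i = 0) :
    ∀ᶠ e in 𝓝 (0 : ℝ), ∀ i, 0 ≤ x i + e * d i := by
  rw [eventually_all]
  intro i
  rcases (hx i).eq_or_lt with h | h
  · simp [hd i h.symm, ← h]
  · have hc : Tendsto (fun e : ℝ => x i + e * d i) (𝓝 0) (𝓝 (x i + 0 * d i)) :=
      Continuous.tendsto (by fun_prop) 0
    rw [zero_mul, add_zero] at hc
    filter_upwards [hc.eventually (lt_mem_nhds h)] with e he using he.le

section
variable {n m : ℕ}

theorem mem_convexHull_range_iff {s : Fin m → Fin n → ℝ} {p : Fin n → ℝ} :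
    p ∈ convexHull ℝ (Set.range s) ↔
      ∃ w ∈ stdSimplex ℝ (Fin m), p = fun i => ∑ j, w j * s j i := by
  constructor
  · intro hp
    refine convexHull_min (t := {p | ∃ w ∈ stdSimplex ℝ (Fin m), p = fun i => ∑ j, w j * s j i})
      ?_ ?_ hp
    · rintro _ ⟨j, rfl⟩
      refine ⟨Pi.single j 1, single_mem_stdSimplex ℝ j, ?_⟩
      funext i
      simp [Pi.single_apply]
    · rintro _ ⟨w, hw, rfl⟩ _ ⟨w', hw', rfl⟩ a b ha hb hab
      refine ⟨a • w + b • w', convex_stdSimplex ℝ _ hw hw' ha hb hab, ?_⟩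
      funext i
      simp only [Pi.add_apply, Pi.smul_apply, smul_eq_mul, Finset.mul_sum, add_mul,
        Finset.sum_add_distrib, mul_assoc]
  · rintro ⟨w, hw, rfl⟩
    have : (fun i => ∑ j, w j * s j i) = ∑ j, w j • s j := by
      funext i
      simp
    rw [this]
    exact (convex_convexHull ℝ _).sum_mem (fun j _ => hw.1 j) hw.2
      fun j _ => subset_convexHull ℝ _ ⟨j, rfl⟩

/-! ### Pointwise minima -/

/-- One point attaining the minimum for each coordinate suffices. For `n = 0` this family would be
empty, whereas `Fmin` asks for a nonempty set. -/
theorem mem_Fmin_iff (hn : 0 < n) {Z : Set (Fin n → ℝ)} {x : Fin n → ℝ} :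
    x ∈ Fmin Z ↔ ∃ p : Fin n → Fin n → ℝ, (∀ i, p i ∈ Z) ∧ (∀ i, p i i = x i) ∧
      ∀ i b, x i ≤ p b i := by
  have : Nonempty (Fin n) := ⟨⟨0, hn⟩⟩
  constructor
  · rintro ⟨P, hP, hPZ, rfl⟩
    choose p hp hp' using fun i : Fin n => P.exists_mem_eq_inf' hP (fun q => q i)
    exact ⟨p, fun i => hPZ (hp i), fun i => (hp' i).symm, fun i b => P.inf'_le _ (hp b)⟩
  · classical
    rintro ⟨p, hpZ, hp, hle⟩
    refine ⟨Finset.univ.image p, Finset.univ_nonempty.image p, ?_, ?_⟩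
    · intro q hq
      simp only [Finset.coe_image, Finset.coe_univ, Set.image_univ, Set.mem_range] at hq
      obtain ⟨i, rfl⟩ := hq
      exact hpZ i
    · funext i
      refine le_antisymm (Finset.le_inf' _ _ ?_) ?_
      · intro q hq
        simp only [Finset.mem_image, Finset.mem_univ, true_and] at hq
        obtain ⟨b, rfl⟩ := hq
        exact hle i b
      · rw [← hp i]
        exact Finset.inf'_le _ (Finset.mem_image_of_mem p (Finset.mem_univ i))

theorem subset_Fmin (Z : Set (Fin n → ℝ)) : Z ⊆ Fmin Z := fun p hp =>
  ⟨{p}, Finset.singleton_nonempty p, by simpa using hp, by funext i; simp [fmin]⟩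

theorem Fmin_mono {Z Z' : Set (Fin n → ℝ)} (h : Z ⊆ Z') : Fmin Z ⊆ Fmin Z' := by
  rintro x ⟨P, hP, hPZ, hx⟩
  exact ⟨P, hP, hPZ.trans h, hx⟩

/-- Witnesses for the same coordinate are combined with the same coefficients; equalities and
inequalities survive. -/
theorem Convex.Fmin (hn : 0 < n) {Z : Set (Fin n → ℝ)} (hZ : Convex ℝ Z) :
    Convex ℝ (Fmin Z) := by
  intro x hx y hy a b ha hb hab
  obtain ⟨p, hp, hpx, hpl⟩ := (mem_Fmin_iff hn).1 hx
  obtain ⟨q, hq, hqy, hql⟩ := (mem_Fmin_iff hn).1 hy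
  refine (mem_Fmin_iff hn).2 ⟨fun i => a • p i + b • q i, fun i => hZ (hp i) (hq i) ha hb hab,
    fun i => by simp [hpx, hqy], fun i c => ?_⟩
  exact add_le_add (mul_le_mul_of_nonneg_left (hpl i c) ha)
    (mul_le_mul_of_nonneg_left (hql i c) hb)

theorem Set.Finite.Fmin {Z : Set (Fin n → ℝ)} (hZ : Z.Finite) : (Fmin Z).Finite := by
  classical
  refine (hZ.toFinset.powerset.finite_toSet.image
    fun P => if hP : P.Nonempty then fmin P hP else 0).subset ?_
  rintro x ⟨P, hP, hPZ, rfl⟩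
  refine ⟨P, ?_, by simp only [dif_pos hP]⟩
  simpa using hPZ

/-! ### The polytope of weights -/

/-- The tuples of weight vectors whose points have the pointwise minimum on the diagonal. -/
def weightPolytope (s : Fin m → Fin n → ℝ) : Set (Fin n → Fin m → ℝ) :=
  {l | (∀ i, l i ∈ stdSimplex ℝ (Fin m)) ∧ ∀ i b, ∑ j, l i j * s j i ≤ ∑ j, l b j * s j i}

/-- The point on the diagonal. -/
def diagonalPoint (s : Fin m → Fin n → ℝ) : (Fin n → Fin m → ℝ) →ₗ[ℝ] Fin n → ℝ where
  toFun l i := ∑ j, l i j * s j i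
  map_add' l l' := by
    funext i
    simp [add_mul, Finset.sum_add_distrib]
  map_smul' c l := by
    funext i
    simp [Finset.mul_sum, mul_assoc]

theorem exists_weights_of_mem_Fmin (hn : 0 < n) {s : Fin m → Fin n → ℝ} {x : Fin n → ℝ}
    (hx : x ∈ Fmin (convexHull ℝ (Set.range s))) : ∃ l ∈ weightPolytope s, diagonalPoint s l = x := by
  obtain ⟨p, hp, hpx, hle⟩ := (mem_Fmin_iff hn).1 hx
  choose w hw hpw using fun i => mem_convexHull_range_iff.1 (hp i)
  have hxi : ∀ i, ∑ j, w i j * s j i = x i := fun i => by rw [← hpx i, hpw i]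
  refine ⟨w, ⟨hw, fun i b => ?_⟩, funext hxi⟩
  have := hle i b
  rw [hpw b] at this
  rwa [hxi]

theorem convex_weightPolytope (s : Fin m → Fin n → ℝ) : Convex ℝ (weightPolytope s) := by
  rintro l ⟨hl, hle⟩ l' ⟨hl', hle'⟩ a b ha hb hab
  refine ⟨fun i => convex_stdSimplex ℝ _ (hl i) (hl' i) ha hb hab, fun i c => ?_⟩
  simp only [Pi.add_apply, Pi.smul_apply, smul_eq_mul, add_mul, Finset.sum_add_distrib, mul_assoc,
    ← Finset.mul_sum]
  exact add_le_add (mul_le_mul_of_nonneg_left (hle i c) ha)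
    (mul_le_mul_of_nonneg_left (hle' i c) hb)

theorem isCompact_weightPolytope (s : Fin m → Fin n → ℝ) : IsCompact (weightPolytope s) := by
  have h1 : IsCompact (Set.univ.pi fun _ : Fin n => stdSimplex ℝ (Fin m)) :=
    isCompact_univ_pi fun _ => isCompact_stdSimplex ℝ _
  have h2 : IsClosed {l : Fin n → Fin m → ℝ |
      ∀ i b, ∑ j, l i j * s j i ≤ ∑ j, l b j * s j i} := by
    simp only [Set.ofPred_forall]
    exact isClosed_iInter fun i => isClosed_iInter fun b => isClosed_le (by fun_prop) (by fun_prop)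
  convert h1.inter_right h2 using 1
  ext l
  simp [weightPolytope]

/-- The support of a tuple of weights. -/
noncomputable def weightSupport (l : Fin n → Fin m → ℝ) : Finset (Fin n × Fin m) :=
  Finset.univ.filter fun x => l x.1 x.2 ≠ 0

/-- The tight inequalities. -/
noncomputable def weightTight (s : Fin m → Fin n → ℝ) (l : Fin n → Fin m → ℝ) :
    Finset (Fin n × Fin n) :=
  Finset.univ.filter fun x => ∑ j, l x.2 j * s j x.1 = ∑ j, l x.1 j * s j x.1

theorem sysNull_weights {s : Fin m → Fin n → ℝ} {l : Fin n → Fin m → ℝ}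
    (hl : l ∈ weightPolytope s) : SysNull s (weightSupport l) (weightTight s l) l 1 where
  supp a j h := by simpa [weightSupport] using h
  sum a := (hl.1 a).2
  tight i b h := by simpa [weightTight] using h

open Filter Topology in
/-- At an extreme point the linear system has only one solution up to scaling. -/
theorem eq_zero_of_mem_extremePoints {s : Fin m → Fin n → ℝ} {l : Fin n → Fin m → ℝ}
    (hl : l ∈ (weightPolytope s).extremePoints ℝ) {d : Fin n → Fin m → ℝ}
    (hd : SysNull s (weightSupport l) (weightTight s l) d 0) : d = 0 := by
  have hlw := hl.1
  -- Weights and slacks are treated alike: those that are zero do not move along `d`, and the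
  -- positive ones tolerate a small move. So `l` is the midpoint of a segment in direction `d`
  -- inside the polytope.
  have h1 : ∀ᶠ e in 𝓝 (0 : ℝ), ∀ x : Fin n × Fin m, 0 ≤ l x.1 x.2 + e * d x.1 x.2 :=
    eventually_forall_nonneg_add_mul (fun x => (hlw.1 x.1).1 x.2)
      fun x hx => hd.supp _ _ (by simp [weightSupport, hx])
  have h2 : ∀ᶠ e in 𝓝 (0 : ℝ), ∀ x : Fin n × Fin n,
      0 ≤ (∑ j, l x.2 j * s j x.1 - ∑ j, l x.1 j * s j x.1) +
        e * (∑ j, d x.2 j * s j x.1 - ∑ j, d x.1 j * s j x.1) :=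
    eventually_forall_nonneg_add_mul (fun x => sub_nonneg.2 (hlw.2 x.1 x.2)) fun x hx => by
      rw [sub_eq_zero]
      refine hd.tight _ _ ?_
      simpa [weightTight] using sub_eq_zero.1 hx
  have hmem : ∀ᶠ e in 𝓝 (0 : ℝ), l + e • d ∈ weightPolytope s := by
    filter_upwards [h1, h2] with e he1 he2
    refine ⟨fun i => ⟨fun j => he1 (i, j), ?_⟩, fun i b => ?_⟩
    · simp only [Pi.add_apply, Pi.smul_apply, smul_eq_mul, Finset.sum_add_distrib, ← Finset.mul_sum,
        (hlw.1 i).2, hd.sum i, mul_zero, add_zero]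
    · have := he2 (i, b)
      simp only [Pi.add_apply, Pi.smul_apply, smul_eq_mul, add_mul, Finset.sum_add_distrib,
        mul_assoc, ← Finset.mul_sum]
      linarith
  obtain ⟨r, hr, hball⟩ := Metric.eventually_nhds_iff.1 hmem
  have hp : l + (r / 2) • d ∈ weightPolytope s := hball (by
    rw [Real.dist_eq, sub_zero, abs_of_pos (half_pos hr)]; exact half_lt_self hr)
  have hm : l + (-(r / 2)) • d ∈ weightPolytope s := hball (by
    rw [Real.dist_eq, sub_zero, abs_neg, abs_of_pos (half_pos hr)]; exact half_lt_self hr)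
  have hseg : l ∈ openSegment ℝ (l + (r / 2) • d) (l + (-(r / 2)) • d) := by
    refine ⟨1 / 2, 1 / 2, by norm_num, by norm_num, by norm_num, ?_⟩
    funext i j
    simp
    ring
  have heq := hl.2 hp hm hseg
  funext i j
  have := congrFun (congrFun heq i) j
  simp only [Pi.add_apply, Pi.smul_apply, smul_eq_mul] at this
  have hz : r / 2 * d i j = 0 := by linarith
  rcases mul_eq_zero.1 hz with h | h
  · linarith
  · exact h

/-- The solution space is the line through `(l, 1)`, and the last unit vector projects to `(l, 1)`
divided by its squared norm. In particular `t > 0`, and dividing by `t` recovers `l`. -/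
theorem isSysProj_of_mem_extremePoints {s : Fin m → Fin n → ℝ} {l : Fin n → Fin m → ℝ}
    (hl : l ∈ (weightPolytope s).extremePoints ℝ) :
    IsSysProj s (weightSupport l) (weightTight s l)
      (fun a j => l a j / (∑ a, ∑ j, l a j * l a j + 1)) (1 / (∑ a, ∑ j, l a j * l a j + 1)) := by
  set q := ∑ a, ∑ j, l a j * l a j + 1 with hq
  have hq0 : 0 < q := by
    have : 0 ≤ ∑ a, ∑ j, l a j * l a j :=
      Finset.sum_nonneg fun a _ => Finset.sum_nonneg fun j _ => mul_self_nonneg _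
    linarith
  have hnull := sysNull_weights hl.1
  refine ⟨⟨fun a j h => by simp [hnull.supp a j h], fun a => ?_, fun i b h => ?_⟩, ?_⟩
  · rw [← Finset.sum_div, hnull.sum a]
  · simp only [div_mul_eq_mul_div, ← Finset.sum_div, hnull.tight i b h]
  · intro y' t' h'
    -- Subtracting `t'` times `(l, 1)` makes the common sum zero, and then extremality applies.
    have hdiff : SysNull s (weightSupport l) (weightTight s l) (fun a j => y' a j - t' * l a j) 0 := by
      refine ⟨fun a j h => by simp [hnull.supp a j h, h'.supp a j h], fun a => ?_,
        fun i b h => ?_⟩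
      · rw [Finset.sum_sub_distrib, ← Finset.mul_sum, hnull.sum a, h'.sum a]
        ring
      · simp only [sub_mul, Finset.sum_sub_distrib, mul_assoc, ← Finset.mul_sum, hnull.tight i b h,
          h'.tight i b h]
    have hy : ∀ a j, y' a j = t' * l a j := fun a j => by
      have := congrFun (congrFun (eq_zero_of_mem_extremePoints hl hdiff) a) j
      exact sub_eq_zero.1 this
    have h1 : ∀ a j, l a j / q * y' a j = t' / q * (l a j * l a j) := fun a j => by
      rw [hy]; ring
    simp only [h1, ← Finset.mul_sum]
    have h2 : ∑ a, ∑ j, l a j * l a j = q - 1 := by rw [hq]; ring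
    rw [h2]
    field_simp
    ring

/-- The support of an extreme point at which not all inequalities are tight is small. -/
theorem card_weightSupport_le {s : Fin m → Fin n → ℝ} {l : Fin n → Fin m → ℝ}
    (hl : l ∈ (weightPolytope s).extremePoints ℝ)
    (hne : ¬ ∀ i b, ∑ j, l b j * s j i = ∑ j, l i j * s j i) :
    (weightSupport l).card ≤ n * n - 1 := by
  set A := weightSupport l with hA
  set T := (weightTight s l).filter fun x => x.1 ≠ x.2 with hT
  -- The diagonal constraints are void, and at least one of the `n * n - n` others is not tight.
  have hTcard : T.card < n * n - n := by
    have h1 : T ⊂ (Finset.univ : Finset (Fin n)).offDiag := by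
      refine Finset.ssubset_iff_subset_ne.2 ⟨fun x hx => ?_, fun he => hne fun i b => ?_⟩
      · simp only [hT, Finset.mem_filter] at hx
        simp [hx.2]
      · by_cases hib : i = b
        · rw [hib]
        · have : (i, b) ∈ T := by rw [he]; simp [hib]
          simp only [hT, Finset.mem_filter, weightTight, Finset.mem_univ, true_and] at this
          exact this.1
    have h2 := Finset.card_lt_card h1
    rwa [Finset.offDiag_card, Finset.card_univ, Fintype.card_fin] at h2
  let E : (A → ℝ) → Fin n → Fin m → ℝ := fun w a j =>
    if h : (a, j) ∈ A then w ⟨(a, j), h⟩ else 0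
  have hEadd : ∀ w w' a j, E (w + w') a j = E w a j + E w' a j := by
    intro w w' a j
    simp only [E]
    split_ifs <;> simp
  have hEsmul : ∀ (c : ℝ) w a j, E (c • w) a j = c * E w a j := by
    intro c w a j
    simp only [E]
    split_ifs <;> simp
  -- Weights on `A`, extended by zero, are sent to their `n` block sums and the defects of the tight
  -- constraints. Extremality makes this injective, so `A` has at most `n` plus the cardinality of
  -- `T` elements.
  let L : (A → ℝ) →ₗ[ℝ] (Fin n ⊕ T → ℝ) :=
    { toFun := fun w => Sum.elim (fun a => ∑ j, E w a j)
        (fun x => ∑ j, E w x.1.2 j * s j x.1.1 - ∑ j, E w x.1.1 j * s j x.1.1)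
      map_add' := by
        intro w w'
        funext x
        rcases x with a | x
        · simp [hEadd, Finset.sum_add_distrib]
        · simp only [Sum.elim_inr, Pi.add_apply, hEadd, add_mul, Finset.sum_add_distrib]
          ring
      map_smul' := by
        intro c w
        funext x
        rcases x with a | x
        · simp [hEsmul, Finset.mul_sum]
        · simp only [Sum.elim_inr, Pi.smul_apply, hEsmul, mul_assoc, ← Finset.mul_sum,
            RingHom.id_apply, smul_eq_mul]
          ring }
  have hinj : Function.Injective L := by
    rw [← LinearMap.ker_eq_bot, LinearMap.ker_eq_bot']
    intro w hw
    have hnull : SysNull s A (weightTight s l) (E w) 0 := by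
      refine ⟨fun a j h => by simp [E, h], fun a => ?_, fun i b h => ?_⟩
      · exact congrFun hw (.inl a)
      · by_cases hib : i = b
        · rw [hib]
        · exact sub_eq_zero.1 (congrFun hw (.inr ⟨(i, b), Finset.mem_filter.2 ⟨h, hib⟩⟩))
    have hE := eq_zero_of_mem_extremePoints hl hnull
    funext x
    have := congrFun (congrFun hE x.1.1) x.1.2
    simpa [E] using this
  have hcard := LinearMap.finrank_le_finrank_of_injective hinj
  simp only [Module.finrank_fintype_fun_eq_card, Fintype.card_coe, Fintype.card_sum,
    Fintype.card_fin] at hcard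
  have : n ≤ n * n := Nat.le_mul_self n
  omega

end

/-! ### The enumeration reaches every extreme point -/

namespace RealRAM

section
variable {n m : ℕ} {s : Fin m → Fin n → ℝ}

theorem exists_digit_eq {g : ℕ → ℕ} {K : ℕ} (hg : ∀ k < K, g k < n * m) :
    ∃ c < (n * m) ^ K, ∀ k < K, digit n m c k = g k := by
  set f : Fin K → Fin (n * m) := fun k => ⟨g k, hg k k.2⟩ with hf
  refine ⟨finFunctionFinEquiv f, (finFunctionFinEquiv f).2, fun k hk => ?_⟩
  have := congrFun (finFunctionFinEquiv.symm_apply_apply f) ⟨k, hk⟩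
  -- The inverse of `finFunctionFinEquiv` extracts digits by the very formula in `digit`.
  exact congrArg Fin.val this

theorem _root_.SysNull.congr_tight {A : Finset (Fin n × Fin m)} {T T' : Finset (Fin n × Fin n)}
    (h : ∀ x : Fin n × Fin n, x.1 ≠ x.2 → (x ∈ T' → x ∈ T)) {y : Fin n → Fin m → ℝ} {t : ℝ}
    (hy : SysNull s A T y t) : SysNull s A T' y t := by
  refine ⟨hy.supp, hy.sum, fun i b hib => ?_⟩
  by_cases h' : i = b
  · rw [h']
  · exact hy.tight i b (h (i, b) h' hib)

/-- The weights of each block add up to `t`, so after division by `t` a nonnegative block consists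
of convex weights, whatever the system was. -/
theorem sysPoints_subset_convexHull (A : Finset (Fin n × Fin m)) (T : Finset (Fin n × Fin n)) :
    sysPoints s A T ⊆ convexHull ℝ (Set.range s) := by
  rintro _ ⟨y, t, a, hyt, ht, hy, rfl⟩
  refine mem_convexHull_range_iff.2 ⟨fun j => y a j / t, ⟨fun j => div_nonneg (hy j) ht.le, ?_⟩, ?_⟩
  · rw [← Finset.sum_div, hyt.null.sum a, div_self ht.ne']
  · simp only [div_mul_eq_mul_div, Finset.sum_div]

theorem foundPoints_subset_convexHull : foundPoints s ⊆ convexHull ℝ (Set.range s) := by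
  rintro p (hp | ⟨c, -, hp⟩)
  · exact subset_convexHull ℝ _ hp
  · exact sysPoints_subset_convexHull _ _ hp

/-- Every small support and every set of tight constraints is given by some digits. -/
theorem exists_digit_system {A : Finset (Fin n × Fin m)} (hA : A.Nonempty)
    (hcard : A.card ≤ n * n - 1) (T : Finset (Fin n × Fin n)) :
    ∃ c < (n * m) ^ (n * n - 1 + n * n), digitSupport n m (digit n m c) = A ∧
      digitTight n (digit n m c) = T := by
  classical
  have hcA := hA.card_pos
  -- A nonempty support with at most `n * n - 1` elements excludes `n = 1`. The base is then at
  -- least 2, so that there is a digit 1 for constraints not in `T`.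
  have hn2 : 2 ≤ n := by
    by_contra h
    have : n ≤ 1 := by omega
    have := Nat.mul_le_mul this this
    omega
  have hm1 : 1 ≤ m := by
    obtain ⟨x, -⟩ := hA
    have := x.2.2
    omega
  have hnm : 2 ≤ n * m := le_trans hn2 (Nat.le_mul_of_pos_right n hm1)
  have : Nonempty A := hA.to_subtype
  obtain ⟨e⟩ : Nonempty (A ↪ Fin (n * n - 1)) :=
    Function.Embedding.nonempty_of_card_le (by simpa using hcard)
  -- A smaller support is listed with repetitions to fill all `n * n - 1` digits.
  have hsurj : Function.Surjective (Function.invFun e) := Function.invFun_surjective e.injective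
  set f := Function.invFun e with hf
  set g : ℕ → ℕ := fun k => if h : k < n * n - 1 then (f ⟨k, h⟩).1.1 * m + (f ⟨k, h⟩).1.2 else
    if ∃ x ∈ T, (x.1 : ℕ) * n + x.2 = k - (n * n - 1) then 0 else 1 with hg
  obtain ⟨c, hc, hdig⟩ := exists_digit_eq (n := n) (m := m) (g := g) (K := n * n - 1 + n * n) (by
    intro k hk
    simp only [hg]
    split_ifs
    · exact mul_add_lt_mul (Fin.is_lt _) (Fin.is_lt _)
    · omega
    · omega)
  refine ⟨c, hc, ?_, ?_⟩
  · rw [digitSupport_congr hdig]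
    ext x
    simp only [digitSupport, Finset.mem_filter_univ]
    constructor
    · rintro ⟨k, hk, hgk⟩
      simp only [hg, dif_pos hk] at hgk
      have h1 : x = (f ⟨k, hk⟩).1 := by
        have hd := congrArg (· / m) hgk
        have hmo := congrArg (· % m) hgk
        simp only [mul_add_div_eq (Fin.is_lt _), mul_add_mod_eq (Fin.is_lt _)] at hd hmo
        exact Prod.ext (Fin.ext hd.symm) (Fin.ext hmo.symm)
      rw [h1]
      exact (f ⟨k, hk⟩).2
    · intro hx
      obtain ⟨k, hk⟩ := hsurj ⟨x, hx⟩
      refine ⟨k, k.2, ?_⟩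
      simp only [hg, dif_pos k.2, Fin.eta, hk]
  · rw [digitTight_congr hdig]
    ext x
    simp only [digitTight, Finset.mem_filter_univ]
    have h0 : ¬ n * n - 1 + ((x.1 : ℕ) * n + x.2) < n * n - 1 := by omega
    simp only [hg, dif_neg h0, Nat.add_sub_cancel_left]
    constructor
    · intro h
      split_ifs at h with h'
      obtain ⟨y, hy, hyx⟩ := h'
      have h1 : y = x := by
        have hd := congrArg (· / n) hyx
        have hmo := congrArg (· % n) hyx
        simp only [mul_add_div_eq (Fin.is_lt _), mul_add_mod_eq (Fin.is_lt _)] at hd hmo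
        exact Prod.ext (Fin.ext hd) (Fin.ext hmo)
      rwa [← h1]
    · intro h
      rw [if_pos ⟨x, h, rfl⟩]

/-- If everything is tight, all witnesses coincide and the point is a convex combination of the
input. Otherwise the support is small, its system is enumerated, and all `n` witnesses are among the
found points. -/
theorem diagonalPoint_mem_of_extreme (hn : 0 < n) {l : Fin n → Fin m → ℝ}
    (hl : l ∈ (weightPolytope s).extremePoints ℝ) :
    diagonalPoint s l ∈ convexHull ℝ (Fmin (foundPoints s)) := by
  by_cases hall : ∀ i b, ∑ j, l b j * s j i = ∑ j, l i j * s j i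
  · have h1 : diagonalPoint s l = fun i => ∑ j, l ⟨0, hn⟩ j * s j i :=
      funext fun i => (hall i _).symm
    rw [h1]
    refine convexHull_mono ?_ (mem_convexHull_range_iff.2 ⟨l ⟨0, hn⟩, hl.1.1 _, rfl⟩)
    exact Set.subset_union_left.trans (subset_Fmin _)
  · refine subset_convexHull ℝ _ ((mem_Fmin_iff hn).2
      ⟨fun a i => ∑ j, l a j * s j i, fun a => .inr ?_, fun i => rfl, fun i b => hl.1.2 i b⟩)
    have hA : (weightSupport l).Nonempty := by
      by_contra h
      rw [Finset.not_nonempty_iff_eq_empty] at h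
      have h2 := (hl.1.1 ⟨0, hn⟩).2
      have h3 : ∀ j, l ⟨0, hn⟩ j = 0 := fun j => by
        have : ((⟨0, hn⟩, j) : Fin n × Fin m) ∉ weightSupport l := by simp [h]
        simpa [weightSupport] using this
      simp [h3] at h2
    obtain ⟨c, hc, hcA, hcT⟩ := exists_digit_system hA (card_weightSupport_le hl hall)
      (weightTight s l)
    refine ⟨c, hc, ?_⟩
    rw [hcA, hcT]
    have hq : 0 < ∑ a, ∑ j, l a j * l a j + 1 := by
      have : 0 ≤ ∑ a, ∑ j, l a j * l a j :=
        Finset.sum_nonneg fun a _ => Finset.sum_nonneg fun j _ => mul_self_nonneg _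
      linarith
    refine ⟨_, _, a, isSysProj_of_mem_extremePoints hl, by positivity,
      fun j => div_nonneg ((hl.1.1 a).1 j) hq.le, ?_⟩
    funext i
    simp only [div_mul_eq_mul_div, ← Finset.sum_div]
    field_simp

/-- Krein–Milman on the weight polytope: the preimage of the right side under the linear map
`diagonalPoint` is convex and, by finiteness, closed, so containing the extreme points is enough. -/
theorem Fmin_convexHull_eq (hn : 0 < n) (hfin : (foundPoints s).Finite) :
    Fmin (convexHull ℝ (Set.range s)) = convexHull ℝ (Fmin (foundPoints s)) := by
  refine Set.Subset.antisymm ?_ ?_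
  · intro x hx
    obtain ⟨l, hl, rfl⟩ := exists_weights_of_mem_Fmin hn hx
    rw [← closure_convexHull_extremePoints (isCompact_weightPolytope s)
      (convex_weightPolytope s)] at hl
    have hclosed : IsClosed (diagonalPoint s ⁻¹' convexHull ℝ (Fmin (foundPoints s))) :=
      (hfin.Fmin.isClosed_convexHull ℝ).preimage
        (LinearMap.continuous_of_finiteDimensional (diagonalPoint s))
    refine closure_minimal (convexHull_min ?_ ?_) hclosed hl
    · exact fun l hl => diagonalPoint_mem_of_extreme hn hl
    · exact (convex_convexHull ℝ _).linear_preimage _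
  · exact convexHull_min (Fmin_mono foundPoints_subset_convexHull)
      ((convex_convexHull ℝ _).Fmin hn)

end

end RealRAM

/-! ### Counting the found points and the rounds -/

namespace RealRAM

section
variable {n m : ℕ} {s : Fin m → Fin n → ℝ}

/-- Diagonal constraints are void. Dropping them saves a factor `2 ^ n` in the count. -/
theorem sysPoints_congr_tight {A : Finset (Fin n × Fin m)} {T T' : Finset (Fin n × Fin n)}
    (h : ∀ x : Fin n × Fin n, x.1 ≠ x.2 → (x ∈ T ↔ x ∈ T')) : sysPoints s A T ⊆ sysPoints s A T' := by
  rintro p ⟨y, t, a, hyt, ht, hy, hp⟩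
  refine ⟨y, t, a, ⟨hyt.null.congr_tight fun x hx => (h x hx).2, fun y' t' h' => ?_⟩, ht, hy, hp⟩
  exact hyt.proj y' t' (h'.congr_tight fun x hx => (h x hx).1)

theorem card_digitSupport_le (g : ℕ → ℕ) : (digitSupport n m g).card ≤ n * n - 1 := by
  have h := Finset.card_le_card_of_injOn (s := digitSupport n m g)
    (t := (Finset.range (n * n - 1)).image g) (fun x => x.1 * m + x.2) ?_ ?_
  · exact h.trans (Finset.card_image_le.trans (Finset.card_range _).le)
  · intro x hx
    simpa [digitSupport] using hx
  · intro x _ y _ hxy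
    have hd := congrArg (· / m) hxy
    have hmo := congrArg (· % m) hxy
    simp only [mul_add_div_eq (Fin.is_lt _), mul_add_mod_eq (Fin.is_lt _)] at hd hmo
    exact Prod.ext (Fin.ext hd) (Fin.ext hmo)

/-- The point of the block `a` in the solution of a linear system. -/
noncomputable def systemPoint (s : Fin m → Fin n → ℝ)
    (x : (Finset (Fin n × Fin m) × Finset (Fin n × Fin n)) × Fin n) : Fin n → ℝ :=
  open Classical in
  if h : ∃ y : (Fin n → Fin m → ℝ) × ℝ, IsSysProj s x.1.1 x.1.2 y.1 y.2 then
    fun i => (∑ j, h.choose.1 x.2 j * s j i) / h.choose.2 else 0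

/-- The linear systems that are considered. -/
def systems (n m : ℕ) : Finset ((Finset (Fin n × Fin m) × Finset (Fin n × Fin n)) × Fin n) :=
  (((Finset.univ.powerset.filter fun A => A.card ≤ n * n - 1) ×ˢ
    (Finset.univ : Finset (Fin n)).offDiag.powerset) ×ˢ Finset.univ)

/-- Many numerals code the same system. Counting systems and blocks instead of numerals is what
makes the size bound sharp enough. -/
theorem foundPoints_subset_image :
    foundPoints s ⊆ Set.range s ∪ systemPoint s '' (systems n m : Set _) := by
  rintro p (hp | ⟨c, -, hp⟩)
  · exact .inl hp
  · right
    obtain ⟨y, t, a, hyt, -, -, rfl⟩ := sysPoints_congr_tight (T' := (digitTight n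
      (digit n m c)).filter fun x => x.1 ≠ x.2) (fun x hx => by simp [hx]) hp
    refine ⟨((digitSupport n m (digit n m c), (digitTight n (digit n m c)).filter
      fun x => x.1 ≠ x.2), a), ?_, ?_⟩
    · simp only [systems, Finset.coe_product, Set.mem_prod, Finset.mem_coe, Finset.mem_filter,
        Finset.powerset_univ, Finset.mem_univ, true_and, and_true, Finset.mem_powerset]
      refine ⟨card_digitSupport_le _, fun x hx => ?_⟩
      simp only [Finset.mem_filter] at hx
      simp [hx.2]
    · have hex : ∃ z : (Fin n → Fin m → ℝ) × ℝ, IsSysProj s (digitSupport n m (digit n m c))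
          ((digitTight n (digit n m c)).filter fun x => x.1 ≠ x.2) z.1 z.2 := ⟨(y, t), hyt⟩
      obtain ⟨h1, h2⟩ := hex.choose_spec.unique hyt
      simp only [systemPoint]
      rw [dif_pos hex, h1, h2]

theorem finite_foundPoints : (foundPoints s).Finite :=
  ((Set.finite_range s).union ((systems n m).finite_toSet.image _)).subset foundPoints_subset_image

theorem card_systems : (systems n m).card =
    ((Finset.univ : Finset (Fin n × Fin m)).powerset.filter fun A => A.card ≤ n * n - 1).card *
      2 ^ (n * n - n) * n := by
  simp [systems, Finset.card_product, Finset.offDiag_card, Finset.card_powerset]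

/-- Each counted `A` has weight `m ^ (L - |A|) ≥ 1`. Summing `m ^ L * (1 / m) ^ |A|` over all
subsets gives `m ^ L * (1 + 1 / m) ^ (n * m)` by the binomial theorem. -/
theorem card_filter_powerset_le {ι : Type*} (S : Finset ι) (hm : 1 ≤ m) (L : ℕ)
    (hS : S.card = n * m) :
    ((S.powerset.filter fun A => A.card ≤ L).card : ℝ) ≤ m ^ L * Real.exp n := by
  have hm0 : (1 : ℝ) ≤ m := by exact_mod_cast hm
  have hpos : (0 : ℝ) < m := by linarith
  have h1 : ((S.powerset.filter fun A => A.card ≤ L).card : ℝ) ≤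
      ∑ A ∈ S.powerset, (m : ℝ) ^ L * ((1 / m : ℝ) ^ A.card * 1 ^ (S.card - A.card)) := by
    rw [← nsmul_one, ← Finset.sum_const]
    refine (Finset.sum_le_sum fun A hA => ?_).trans
      (Finset.sum_le_sum_of_subset_of_nonneg (Finset.filter_subset _ _) fun A _ _ => by positivity)
    have hA' := (Finset.mem_filter.1 hA).2
    rw [one_pow, mul_one, one_div, inv_pow, ← div_eq_mul_inv, le_div_iff₀ (pow_pos hpos _), one_mul]
    exact pow_le_pow_right₀ hm0 hA'
  refine h1.trans ?_
  rw [← Finset.mul_sum, Finset.sum_pow_mul_eq_add_pow, hS]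
  refine mul_le_mul_of_nonneg_left ?_ (by positivity)
  calc (1 / m + 1 : ℝ) ^ (n * m) ≤ Real.exp (1 / m) ^ (n * m) :=
        pow_le_pow_left₀ (by positivity) (Real.add_one_le_exp _) _
    _ = Real.exp n := by
        rw [← Real.exp_nat_mul]
        congr 1
        push_cast
        field_simp

theorem mul_exp_add_one_le (n : ℕ) (hn : 1 ≤ n) : n * Real.exp n + 1 ≤ 4 ^ n := by
  have he := Real.exp_one_lt_d9
  have he0 := Real.exp_pos 1
  have hpow : ∀ k : ℕ, Real.exp k = Real.exp 1 ^ k := fun k => by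
    rw [← Real.exp_nat_mul, mul_one]
  have h3 : ∀ k : ℕ, 3 ≤ k → k * Real.exp k + 1 ≤ 4 ^ k := by
    intro k hk
    induction k, hk using Nat.le_induction with
    | base =>
      rw [hpow]
      have : Real.exp 1 ^ 3 ≤ (2.7182818286 : ℝ) ^ 3 := pow_le_pow_left₀ he0.le he.le 3
      norm_num at this ⊢
      linarith
    | succ k hk ih =>
      have hk' : (3 : ℝ) ≤ k := by exact_mod_cast hk
      have h1 : Real.exp ((k + 1 : ℕ) : ℝ) = Real.exp k * Real.exp 1 := by
        push_cast
        exact Real.exp_add _ _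
      rw [h1, pow_succ]
      -- This fails for `k = 2`, which is why the induction starts at 3.
      have h2 : ((k + 1 : ℕ) : ℝ) * Real.exp 1 ≤ 4 * k := by
        push_cast
        nlinarith
      have h4 := mul_le_mul_of_nonneg_left h2 (Real.exp_pos k).le
      nlinarith
  rcases Nat.lt_or_ge n 3 with h | h
  · interval_cases n
    · norm_num
      linarith
    · rw [hpow]
      have : Real.exp 1 ^ 2 ≤ (2.7182818286 : ℝ) ^ 2 := pow_le_pow_left₀ he0.le he.le 2
      norm_num at this ⊢
      linarith
  · exact h3 n h

/-- There is equality for `n = 3`, so the `- 1` gained in `card_weightSupport_le` is needed. -/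
theorem mul_self_sub_one_le_two_pow (n : ℕ) : n * n - 1 ≤ 2 ^ n := by
  rcases Nat.lt_or_ge n 4 with h | h
  · interval_cases n <;> norm_num
  · suffices h' : n * n ≤ 2 ^ n by omega
    induction n, h using Nat.le_induction with
    | base => norm_num
    | succ k hk ih =>
      rw [pow_succ]
      nlinarith

theorem card_foundPoints_le (hn : 1 ≤ n) (hm : 1 ≤ m) :
    (finite_foundPoints (s := s)).toFinset.card ≤ m ^ (2 ^ n) * 2 ^ (n ^ 2 + n) := by
  classical
  have h1 : (finite_foundPoints (s := s)).toFinset ⊆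
      Finset.univ.image s ∪ (systems n m).image (systemPoint s) := by
    intro p hp
    have := foundPoints_subset_image ((Set.Finite.mem_toFinset _).1 hp)
    simpa using this
  have h2 : (finite_foundPoints (s := s)).toFinset.card ≤ m + (systems n m).card := by
    refine (Finset.card_le_card h1).trans ((Finset.card_union_le _ _).trans (add_le_add ?_ ?_))
    · exact Finset.card_image_le.trans (by simp)
    · exact Finset.card_image_le
  refine h2.trans ?_
  rw [card_systems]
  have h3 := card_filter_powerset_le (n := n) (Finset.univ : Finset (Fin n × Fin m)) hm (n * n - 1)
    (by simp)
  set a := ((Finset.univ : Finset (Fin n × Fin m)).powerset.filter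
    fun A => A.card ≤ n * n - 1).card with ha
  have hm0 : (1 : ℝ) ≤ m := by exact_mod_cast hm
  have h4 : (m : ℝ) ^ (n * n - 1) ≤ (m : ℝ) ^ (2 ^ n) :=
    pow_le_pow_right₀ hm0 (mul_self_sub_one_le_two_pow n)
  have h5 : (m : ℝ) ≤ (m : ℝ) ^ (2 ^ n) := le_self_pow₀ hm0 (by positivity)
  have h6 := mul_exp_add_one_le n hn
  -- The factor `4 ^ n` pays for the `n` blocks, for the `e ^ n` of the supports and, through the
  -- summand 1, for the input points.
  have h7 : (2 : ℝ) ^ (n ^ 2 + n) = 2 ^ (n * n - n) * 4 ^ n := by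
    rw [show (4 : ℝ) = 2 ^ 2 by norm_num, ← pow_mul, ← pow_add]
    congr 1
    have := Nat.le_mul_self n
    rw [sq]
    omega
  have h8 : (1 : ℝ) ≤ 2 ^ (n * n - n) := one_le_pow₀ (by norm_num)
  have h9 : ((m + a * 2 ^ (n * n - n) * n : ℕ) : ℝ) ≤ (m ^ (2 ^ n) * 2 ^ (n ^ 2 + n) : ℕ) := by
    push_cast
    rw [h7]
    set B : ℝ := (m : ℝ) ^ (2 ^ n)
    set P : ℝ := 2 ^ (n * n - n)
    have hB : 0 ≤ B := by positivity
    have hP : 0 ≤ P := by positivity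
    calc (m : ℝ) + a * P * n ≤ B * P + (B * Real.exp n) * P * n := by
          have : (a : ℝ) ≤ B * Real.exp n :=
            h3.trans (mul_le_mul_of_nonneg_right h4 (Real.exp_pos _).le)
          have h10 : (m : ℝ) ≤ B * P := by nlinarith
          gcongr
      _ = B * (P * (n * Real.exp n + 1)) := by ring
      _ ≤ B * (P * 4 ^ n) := by gcongr
  exact_mod_cast h9

/-- A bound for the number of rounds of each loop of the algorithm. -/
theorem size_le (hn : 1 ≤ n) (hm : 1 ≤ m) :
    n * m + 2 * (n * n) + n + m + 1 ≤ m ^ (8 * (n * 2 ^ n)) * 2 ^ (8 * n ^ 3) ∧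
      (n * m) ^ (n * n - 1 + n * n) * n * n ≤ m ^ (8 * (n * 2 ^ n)) * 2 ^ (8 * n ^ 3) := by
  have h2 : n ≤ 2 ^ n := Nat.lt_two_pow_self.le
  have hn2 : n ≤ n ^ 2 := Nat.le_self_pow (by norm_num) n
  have hn3 : n ^ 2 ≤ n ^ 3 := Nat.pow_le_pow_right hn (by norm_num)
  have hnn : n * n ≤ n * 2 ^ n := Nat.mul_le_mul_left n h2
  have hpos : 1 ≤ n * n := Nat.mul_pos hn hn
  constructor
  · have h3 : n * m + 2 * (n * n) + n + m + 1 ≤ 6 * (n * n * m) := by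
      have a1 : n * m ≤ n * n * m := Nat.mul_le_mul_right m (Nat.le_mul_self n)
      have a2 : n * n ≤ n * n * m := Nat.le_mul_of_pos_right _ hm
      have a3 : n ≤ n * n * m := (Nat.le_mul_self n).trans a2
      have a4 : m ≤ n * n * m := Nat.le_mul_of_pos_left m hpos
      have a5 : 1 ≤ n * n * m := hpos.trans a2
      omega
    refine h3.trans ?_
    calc 6 * (n * n * m) ≤ 2 ^ 3 * (2 ^ n * 2 ^ n * m) := by gcongr; norm_num
      _ = m ^ 1 * 2 ^ (3 + n + n) := by ring
      _ ≤ m ^ (8 * (n * 2 ^ n)) * 2 ^ (8 * n ^ 3) := by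
        refine Nat.mul_le_mul (Nat.pow_le_pow_right hm (by omega))
          (Nat.pow_le_pow_right (by norm_num) (by omega))
  · calc (n * m) ^ (n * n - 1 + n * n) * n * n
        ≤ (2 ^ n * m) ^ (2 * (n * n)) * 2 ^ n * 2 ^ n := by
          refine Nat.mul_le_mul (Nat.mul_le_mul ?_ h2) h2
          refine (Nat.pow_le_pow_left (Nat.mul_le_mul_right m h2) _).trans ?_
          exact Nat.pow_le_pow_right (Nat.mul_pos (by positivity) hm) (by omega)
      _ = m ^ (2 * (n * n)) * 2 ^ (2 * n ^ 3 + n + n) := by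
          rw [mul_pow, ← pow_mul, show n * (2 * (n * n)) = 2 * n ^ 3 by ring, pow_add, pow_add]
          ring
      _ ≤ m ^ (8 * (n * 2 ^ n)) * 2 ^ (8 * n ^ 3) := by
        refine Nat.mul_le_mul (Nat.pow_le_pow_right hm (by omega))
          (Nat.pow_le_pow_right (by norm_num) (by omega))

end

end RealRAM

theorem mainTheorem5 :
    ∃ (A : RealRAM.Program) (C : ℕ), ∀ (n m : ℕ), 1 ≤ n →
      ∀ S : Finset (Fin n → ℝ), S.Nonempty → S.card = m →
      ∀ s : Fin m → Fin n → ℝ, Set.range s = (S : Set (Fin n → ℝ)) →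
      ∃ (t : ℕ) (τ : RealRAM.State) (S' : Finset (Fin n → ℝ)),
        RealRAM.Exec A (RealRAM.input s) t τ ∧
        t ≤ m ^ (C * (n * 2 ^ n)) * 2 ^ (C * n ^ 3) ∧
        RealRAM.output n τ = (S' : Set (Fin n → ℝ)) ∧
        S'.card ≤ m ^ (2 ^ n) * 2 ^ (n ^ 2 + n) ∧
        (S : Set (Fin n → ℝ)) ⊆ (S' : Set (Fin n → ℝ)) ∧
        (S' : Set (Fin n → ℝ)) ⊆ convexHull ℝ (S : Set (Fin n → ℝ)) ∧
        Fmin (convexHull ℝ (S : Set (Fin n → ℝ))) =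
          convexHull ℝ (Fmin (S' : Set (Fin n → ℝ))) := by
  obtain ⟨c, d, hcd⟩ := RealRAM.closureProgram.exists_timeBound_le
  -- In `c * Z ^ d` the power gives `8 * d` in both exponents, and `c` is absorbed by `2 ^ (c * n ^
  -- 3)`.
  refine ⟨RealRAM.closureProgram, 8 * d + c, ?_⟩
  intro n m hn S hS hcard s hs
  have hm : 1 ≤ m := by rw [← hcard]; exact hS.card_pos
  obtain ⟨hZ, hZ'⟩ := RealRAM.size_le hn hm
  set Z := m ^ (8 * (n * 2 ^ n)) * 2 ^ (8 * n ^ 3) with hZdef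
  obtain ⟨t, ht, τ, hexec, hout⟩ := RealRAM.exec_closureProgram hn hm hZ hZ' s
  have hfin := RealRAM.finite_foundPoints (s := s)
  refine ⟨t, τ, hfin.toFinset, hexec, ?_, ?_, RealRAM.card_foundPoints_le hn hm, ?_, ?_, ?_⟩
  · refine (ht.trans (hcd Z (by omega))).trans ?_
    have hc : c ≤ 2 ^ (c * n ^ 3) := Nat.lt_two_pow_self.le.trans
      (Nat.pow_le_pow_right (by norm_num) (Nat.le_mul_of_pos_right c (by positivity)))
    calc c * Z ^ d ≤ 2 ^ (c * n ^ 3) * Z ^ d := Nat.mul_le_mul_right _ hc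
      _ = m ^ (8 * d * (n * 2 ^ n)) * 2 ^ ((8 * d + c) * n ^ 3) := by
        rw [hZdef, mul_pow, ← pow_mul, ← pow_mul, add_mul (8 * d) c, pow_add 2,
          show 8 * (n * 2 ^ n) * d = 8 * d * (n * 2 ^ n) by ring,
          show 8 * n ^ 3 * d = 8 * d * n ^ 3 by ring]
        ring
      _ ≤ m ^ ((8 * d + c) * (n * 2 ^ n)) * 2 ^ ((8 * d + c) * n ^ 3) :=
        Nat.mul_le_mul_right _ (Nat.pow_le_pow_right hm
          (Nat.mul_le_mul_right _ (Nat.le_add_right _ _)))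
  · rw [hout, hfin.coe_toFinset]
  · rw [hfin.coe_toFinset, ← hs]
    exact Set.subset_union_left
  · rw [hfin.coe_toFinset, ← hs]
    exact RealRAM.foundPoints_subset_convexHull
  · rw [hfin.coe_toFinset, ← hs]
    exact RealRAM.Fmin_convexHull_eq hn hfin
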